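/- Let $\Bbbk$ be an algebraically closed field of characteristic zero, let $\xi\in\Bbbk$ be a primitive $4$-th root of unity and fix $\sqrt2\in\Bbbk$, a square root of $2$. Let $\mathcal K$ be the Hopf algebra generated as an algebra by $a,b,c,d$ with relations $$ab=\xi ba,\quad ac=\xi ca,\quad cb=bc=0,\quad cd=\xi dc,\quad bd=\xi db,\quad ad=da=1,\quad b^2=c^2=0,\quad a^2c=b,\quad a^4=1,$$ with coalgebra structure and antipode determined by $$\Delta(a)=a\otimes a+b\otimes c,\quad \Delta(b)=a\otimes b+b\otimes d,\quad \Delta(c)=c\otimes a+d\otimes c,\quad \Delta(d)=c\otimes b+d\otimes d,$$ $$\varepsilon(a)=\varepsilon(d)=1,\quad \varepsilon(b)=\varepsilon(c)=0,\quad S(a)=d,\quad S(b)=\xi b,\quad S(c)=-\xi c,\quad S(d)=a.$$ Let $\mathcal K^{\mathrm{cop}}$ be the co-opposite Hopf algebra (flipped comultiplication, antipode $S^{-1}$). For a Hopf algebra $H$ with bijective antipode, the Drinfeld double $D(H)$ is, as an algebra, the vector space $H^*\otimes H$, whose element $f\otimes h$ is written $f\bowtie h$, with unit $\varepsilon\bowtie1$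 and product $$(f\bowtie h)(g\bowtie k)=\sum f\cdot g\big(S_H^{-1}(h_{(3)})\,?\,h_{(1)}\big)\bowtie h_{(2)}k ,$$ where $g(S_H^{-1}(q)\,?\,p)$ denotes the functional $u\mapsto g(S_H^{-1}(q)up)$ and $f\cdot f'$ is the convolution product of $H^*$. Let $D=D(\mathcal K^{\mathrm{cop}})$ and write $u$ for $\varepsilon\bowtie u$ ($u\in\mathcal K$). Let $g=\alpha_1\bowtie 1\in D$, where $\alpha_1:\mathcal K\to\Bbbk$ is the algebra map with $\alpha_1(a)=\xi^{-1}$, $\alpha_1(b)=\alpha_1(c)=0$, $\alpha_1(d)=\xi$. Let $x=\theta\bowtie1\in D$, where $\theta$ is the linear functional on $\mathcal K$ with value $\sqrt2\,\xi$ on $b,c,ab,ac$ and value $0$ on $1,a,d,a^2$ (these eight elements form a basis of $\mathcal K$). Put $\Lambda=\{(i,j)\in\mathbb Z_4\times\mathbb Z_4:\ 2i\neq j\}$. Theorem. $\dim_\Bbbk D=64$, and the following hold. (1) For each $j\in\mathbb Z_4$ there is a unique algebra map $\chi^j:D\to\Bbbk$ with $$\chi^j(a)=\xi^j,\quad \chi^j(b)=\chi^j(c)=\chi^j(x)=0,\quad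 \chi^j(d)=\xi^{-j},\quad \chi^j(g)=(-1)^j .$$ Let $\Bbbk_{\chi^j}$ be the corresponding $1$-dimensional left $D$-module. (2) For each $(i,j)\in\Lambda$ there is a unique algebra map $\rho_{i,j}:D\to M_2(\Bbbk)$ with $$\rho_{i,j}(a)=\begin{pmatrix}\xi^i&0\\0&\xi^{i+3}\end{pmatrix},\quad \rho_{i,j}(b)=\begin{pmatrix}0&(-1)^i\\0&0\end{pmatrix},\quad \rho_{i,j}(c)=\begin{pmatrix}0&1\\0&0\end{pmatrix},\quad \rho_{i,j}(d)=\begin{pmatrix}\xi^{-i}&0\\0&\xi^{-i+1}\end{pmatrix},$$ $$\rho_{i,j}(g)=\begin{pmatrix}\xi^j&0\\0&\xi^{j+2}\end{pmatrix},\quad \rho_{i,j}(x)=\begin{pmatrix}0&\tfrac{\sqrt2}{2}\xi(\xi^i+\xi^{3i+j})\\ \sqrt2\,\xi(\xi^{3i}-\xi^{i+j})&0\end{pmatrix}.$$ Let $V_{i,j}=\Bbbk^2$ be the corresponding $2$-dimensional left $D$-module. (3) The four modules $\Bbbk_{\chi^j}$ ($j\in\mathbb Z_4$) and the twelve modules $V_{i,j}$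 ($(i,j)\in\Lambda$) are simple and pairwise non-isomorphic, and every simple left $D$-module is isomorphic to one of them. In particular $D$ has exactly sixteen simple left modules up to isomorphism. -/

import Mathlib

universe u v

open scoped TensorProduct
open WithConv

noncomputable section

/-- A Hopf algebra whose antipode is bijective. -/
class HasBijectiveAntipode (𝕜 : Type*) (H : Type*) [Field 𝕜] [Ring H] [HopfAlgebra 𝕜 H] :
    Prop where
  bijective : Function.Bijective (HopfAlgebra.antipode 𝕜 (A := H))

section InvAntipode

variable (𝕜 : Type*) (H : Type*) [Field 𝕜] [Ring H] [HopfAlgebra 𝕜 H]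

open Coalgebra HopfAlgebra

theorem antipode_comul_left_inv :
    toConv (TensorProduct.map (antipode 𝕜) (antipode 𝕜) ∘ₗ
        (TensorProduct.comm 𝕜 H H).toLinearMap ∘ₗ comul) * toConv (comul (R := 𝕜) (A := H)) = 1 := by
  let W : (H ⊗[𝕜] H) ⊗[𝕜] (H ⊗[𝕜] H) →ₗ[𝕜] H ⊗[𝕜] H :=
    LinearMap.mul' 𝕜 (H ⊗[𝕜] H) ∘ₗ TensorProduct.map (TensorProduct.map (antipode 𝕜) (antipode 𝕜) ∘ₗ
        (TensorProduct.comm 𝕜 H H).toLinearMap) .id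
  let Q : H ⊗[𝕜] ((H ⊗[𝕜] H) ⊗[𝕜] H) →ₗ[𝕜] (H ⊗[𝕜] H) ⊗[𝕜] (H ⊗[𝕜] H) :=
    (TensorProduct.assoc 𝕜 H H (H ⊗[𝕜] H)).symm.toLinearMap ∘ₗ
      TensorProduct.map .id (TensorProduct.assoc 𝕜 H H H).toLinearMap
  have h1 : TensorProduct.map (comul (R := 𝕜) (A := H)) comul ∘ₗ comul =
      Q ∘ₗ TensorProduct.map .id (TensorProduct.map comul .id ∘ₗ comul) ∘ₗ comul := by
    simp only [Q, coassoc_simps]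
  have h2 : ∀ x y z : H, W (Q (x ⊗ₜ (comul (R := 𝕜) y ⊗ₜ z))) =
      counit (R := 𝕜) y • ((1 : H) ⊗ₜ[𝕜] (antipode 𝕜 x * z)) := by
    intro x y z
    rw [← (ℛ 𝕜 y).eq]
    simp only [TensorProduct.sum_tmul, TensorProduct.tmul_sum, map_sum]
    have : ∀ i, W (Q (x ⊗ₜ[𝕜] (((ℛ 𝕜 y).left i ⊗ₜ[𝕜] (ℛ 𝕜 y).right i) ⊗ₜ[𝕜] z))) =
        (antipode 𝕜 ((ℛ 𝕜 y).left i) * (ℛ 𝕜 y).right i) ⊗ₜ (antipode 𝕜 x * z) := fun i => by simp [W, Q]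
    simp only [this]
    rw [← TensorProduct.sum_tmul, sum_antipode_mul_eq_smul, TensorProduct.smul_tmul']
  have h3 : W ∘ₗ Q ∘ₗ TensorProduct.map .id (TensorProduct.map comul .id ∘ₗ comul) =
      TensorProduct.mk 𝕜 H H 1 ∘ₗ LinearMap.mul' 𝕜 H ∘ₗ (antipode 𝕜).rTensor H := by
    ext x y
    simp only [TensorProduct.AlgebraTensorModule.curry_apply, LinearMap.restrictScalars_self,
      TensorProduct.curry_apply, LinearMap.coe_comp, Function.comp_apply,
      TensorProduct.map_tmul, LinearMap.id_apply, TensorProduct.mk_apply, LinearMap.rTensor_tmul,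
      LinearMap.mul'_apply]
    conv_lhs => rw [← (ℛ 𝕜 y).eq]
    simp only [map_sum, TensorProduct.map_tmul, TensorProduct.tmul_sum, LinearMap.id_apply, h2]
    simp only [← TensorProduct.tmul_smul, ← mul_smul_comm]
    rw [← TensorProduct.tmul_sum, ← Finset.mul_sum, sum_counit_smul]
  apply WithConv.ext
  ext h
  have h4 := LinearMap.congr_fun h1 h
  have h5 := LinearMap.congr_fun h3 (comul h)
  simp only [LinearMap.coe_comp, Function.comp_apply] at h4 h5
  have h6 : TensorProduct.map (TensorProduct.map (antipode 𝕜) (antipode 𝕜) ∘ₗ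
        (TensorProduct.comm 𝕜 H H).toLinearMap ∘ₗ comul) (comul (R := 𝕜) (A := H)) =
      TensorProduct.map (TensorProduct.map (antipode 𝕜) (antipode 𝕜) ∘ₗ
        (TensorProduct.comm 𝕜 H H).toLinearMap) .id ∘ₗ
        TensorProduct.map (comul (R := 𝕜) (A := H)) comul := by
    rw [← TensorProduct.map_comp]; rfl
  change LinearMap.mul' 𝕜 (H ⊗[𝕜] H) (TensorProduct.map (TensorProduct.map (antipode 𝕜)
    (antipode 𝕜) ∘ₗ (TensorProduct.comm 𝕜 H H).toLinearMap ∘ₗ comul)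
      (comul (R := 𝕜) (A := H)) (comul h)) = algebraMap 𝕜 (H ⊗[𝕜] H) (counit h)
  rw [h6]
  change W (TensorProduct.map (comul (R := 𝕜) (A := H)) comul (comul h)) = _
  rw [h4, h5, HopfAlgebra.mul_antipode_rTensor_comul_apply]
  simp [Algebra.algebraMap_eq_smul_one, Algebra.TensorProduct.one_def]

theorem comul_comp_antipode :
    comul ∘ₗ antipode 𝕜 (A := H) =
      TensorProduct.map (antipode 𝕜) (antipode 𝕜) ∘ₗ
        (TensorProduct.comm 𝕜 H H).toLinearMap ∘ₗ comul :=
  (WithConv.toConv_injective (left_inv_eq_right_inv (antipode_comul_left_inv 𝕜 H)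
    LinearMap.comul_right_inv)).symm

variable [HasBijectiveAntipode 𝕜 H]

/-- The antipode as a linear automorphism. -/
def antipodeEquiv : H ≃ₗ[𝕜] H :=
  LinearEquiv.ofBijective (HopfAlgebra.antipode 𝕜) HasBijectiveAntipode.bijective

/-- The inverse of the antipode. -/
def invAntipode : H →ₗ[𝕜] H := (antipodeEquiv 𝕜 H).symm.toLinearMap

variable {𝕜 H}

theorem antipode_invAntipode (x : H) : HopfAlgebra.antipode 𝕜 (invAntipode 𝕜 H x) = x :=
  (antipodeEquiv 𝕜 H).apply_symm_apply x

theorem invAntipode_antipode (x : H) : invAntipode 𝕜 H (HopfAlgebra.antipode 𝕜 x) = x :=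
  (antipodeEquiv 𝕜 H).symm_apply_apply x

theorem invAntipode_one : invAntipode 𝕜 H 1 = 1 := by
  conv_lhs => rw [← HopfAlgebra.antipode_one (R := 𝕜) (A := H)]
  exact invAntipode_antipode _

theorem invAntipode_mul (x y : H) :
    invAntipode 𝕜 H (x * y) = invAntipode 𝕜 H y * invAntipode 𝕜 H x := by
  apply (antipodeEquiv 𝕜 H).injective
  change HopfAlgebra.antipode 𝕜 _ = HopfAlgebra.antipode 𝕜 _
  rw [HopfAlgebra.antipode_mul_antidistrib]
  simp only [antipode_invAntipode]

theorem comul_invAntipode (x : H) :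
    comul (invAntipode 𝕜 H x) = TensorProduct.map (invAntipode 𝕜 H) (invAntipode 𝕜 H)
      (TensorProduct.comm 𝕜 H H (comul (R := 𝕜) x)) := by
  have h := LinearMap.congr_fun (comul_comp_antipode 𝕜 H) (invAntipode 𝕜 H x)
  simp only [LinearMap.coe_comp, Function.comp_apply, antipode_invAntipode,
    LinearEquiv.coe_coe] at h
  rw [h]
  generalize comul (R := 𝕜) (invAntipode 𝕜 H x) = z
  induction z with
  | zero => simp
  | add a b ha hb => simpa [map_add] using congr($ha + $hb)
  | tmul a b => simp [invAntipode_antipode]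

end InvAntipode

section Cop

/-- The co-opposite Hopf algebra: same algebra, flipped comultiplication, antipode inverted. -/
def Cop (_𝕜 : Type*) (H : Type*) : Type _ := H

variable (𝕜 : Type*) (H : Type*) [Field 𝕜] [Ring H] [HopfAlgebra 𝕜 H]

instance : Ring (Cop 𝕜 H) := inferInstanceAs (Ring H)

instance : Algebra 𝕜 (Cop 𝕜 H) := inferInstanceAs (Algebra 𝕜 H)

/-- The identity map of the underlying algebras. -/
def toCop : H ≃ₐ[𝕜] Cop 𝕜 H := AlgEquiv.refl

open Coalgebra HopfAlgebra

def copComul : Cop 𝕜 H →ₐ[𝕜] Cop 𝕜 H ⊗[𝕜] Cop 𝕜 H :=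
  ((Algebra.TensorProduct.comm 𝕜 H H).toAlgHom.comp (Bialgebra.comulAlgHom 𝕜 H) :
    H →ₐ[𝕜] H ⊗[𝕜] H)

def copCounit : Cop 𝕜 H →ₐ[𝕜] 𝕜 := Bialgebra.counitAlgHom 𝕜 H

theorem comm_comul_coassoc :
    (TensorProduct.assoc 𝕜 H H H).toLinearMap ∘ₗ
      TensorProduct.map ((TensorProduct.comm 𝕜 H H).toLinearMap ∘ₗ comul) .id ∘ₗ
        ((TensorProduct.comm 𝕜 H H).toLinearMap ∘ₗ comul) =
      TensorProduct.map .id ((TensorProduct.comm 𝕜 H H).toLinearMap ∘ₗ comul) ∘ₗ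
        ((TensorProduct.comm 𝕜 H H).toLinearMap ∘ₗ comul) := by
  let rev : H ⊗[𝕜] (H ⊗[𝕜] H) →ₗ[𝕜] H ⊗[𝕜] (H ⊗[𝕜] H) :=
    (TensorProduct.assoc 𝕜 H H H).toLinearMap ∘ₗ (TensorProduct.comm 𝕜 H (H ⊗[𝕜] H)).toLinearMap ∘ₗ
      TensorProduct.map .id (TensorProduct.comm 𝕜 H H).toLinearMap
  have h1 : ∀ x y z : H, rev (x ⊗ₜ (y ⊗ₜ z)) = z ⊗ₜ (y ⊗ₜ x) := fun x y z => by simp [rev]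
  have h2 : ∀ z : H ⊗[𝕜] H, TensorProduct.assoc 𝕜 H H H
      (TensorProduct.map ((TensorProduct.comm 𝕜 H H).toLinearMap ∘ₗ comul) .id
        (TensorProduct.comm 𝕜 H H z)) = rev ((comul (R := 𝕜)).lTensor H z) := by
    intro z
    induction z with
    | zero => simp
    | add a b ha hb => simp only [map_add, ha, hb]
    | tmul x y =>
      simp only [TensorProduct.comm_tmul, TensorProduct.map_tmul, LinearMap.lTensor_tmul,
        LinearMap.comp_apply, LinearEquiv.coe_coe, LinearMap.id_apply]
      generalize comul (R := 𝕜) y = w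
      induction w with
      | zero => simp
      | add a b ha hb =>
        simp only [map_add, TensorProduct.tmul_add, TensorProduct.add_tmul, ha, hb]
      | tmul a b => simp [h1]
  have h3 : ∀ z : H ⊗[𝕜] H,
      TensorProduct.map .id ((TensorProduct.comm 𝕜 H H).toLinearMap ∘ₗ comul)
        (TensorProduct.comm 𝕜 H H z) =
      rev (TensorProduct.assoc 𝕜 H H H ((comul (R := 𝕜)).rTensor H z)) := by
    intro z
    induction z with
    | zero => simp
    | add a b ha hb => simp only [map_add, ha, hb]
    | tmul x y =>
      simp only [TensorProduct.comm_tmul, TensorProduct.map_tmul, LinearMap.rTensor_tmul,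
        LinearMap.comp_apply, LinearEquiv.coe_coe, LinearMap.id_apply]
      generalize comul (R := 𝕜) x = w
      induction w with
      | zero => simp
      | add a b ha hb =>
        simp only [map_add, TensorProduct.tmul_add, TensorProduct.add_tmul, ha, hb]
      | tmul a b => simp [h1]
  ext h
  refine (h2 _).trans (Eq.trans ?_ (h3 _).symm)
  rw [Coalgebra.coassoc_apply]

theorem comm_comul_counit_left :
    TensorProduct.map counit .id ∘ₗ ((TensorProduct.comm 𝕜 H H).toLinearMap ∘ₗ comul) =
      (TensorProduct.lid 𝕜 H).symm.toLinearMap := by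
  ext h
  have := Coalgebra.lTensor_counit_comul (R := 𝕜) h
  simp only [LinearMap.coe_comp, Function.comp_apply, LinearEquiv.coe_coe,
    TensorProduct.map_comm, LinearMap.lTensor_def] at this ⊢
  rw [this]
  simp

theorem comm_comul_counit_right :
    TensorProduct.map .id counit ∘ₗ ((TensorProduct.comm 𝕜 H H).toLinearMap ∘ₗ comul) =
      (TensorProduct.rid 𝕜 H).symm.toLinearMap := by
  ext h
  have := Coalgebra.rTensor_counit_comul (R := 𝕜) h
  simp only [LinearMap.coe_comp, Function.comp_apply, LinearEquiv.coe_coe,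
    TensorProduct.map_comm, LinearMap.rTensor_def] at this ⊢
  rw [this]
  simp

instance : Bialgebra 𝕜 (Cop 𝕜 H) :=
  Bialgebra.ofAlgHom (copComul 𝕜 H) (copCounit 𝕜 H)
    (AlgHom.toLinearMap_injective (comm_comul_coassoc 𝕜 H))
    (AlgHom.toLinearMap_injective (comm_comul_counit_left 𝕜 H))
    (AlgHom.toLinearMap_injective (comm_comul_counit_right 𝕜 H))

variable [HasBijectiveAntipode 𝕜 H]

theorem invAntipode_cop_left (h : H) :
    LinearMap.mul' 𝕜 H ((invAntipode 𝕜 H).rTensor H (TensorProduct.comm 𝕜 H H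
      (comul (R := 𝕜) h))) = algebraMap 𝕜 H (counit h) := by
  apply (antipodeEquiv 𝕜 H).injective
  have h1 : ∀ z : H ⊗[𝕜] H, antipode 𝕜 (LinearMap.mul' 𝕜 H ((invAntipode 𝕜 H).rTensor H
      (TensorProduct.comm 𝕜 H H z))) =
      LinearMap.mul' 𝕜 H ((antipode 𝕜).rTensor H z) := by
    intro z
    induction z with
    | zero => simp
    | add a b ha hb => simpa [map_add] using congr($ha + $hb)
    | tmul a b => simp [antipode_mul_antidistrib, antipode_invAntipode]
  refine (h1 _).trans ?_
  rw [mul_antipode_rTensor_comul_apply]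
  change _ = antipode 𝕜 _
  rw [Algebra.algebraMap_eq_smul_one, map_smul, antipode_one]

theorem invAntipode_cop_right (h : H) :
    LinearMap.mul' 𝕜 H ((invAntipode 𝕜 H).lTensor H (TensorProduct.comm 𝕜 H H
      (comul (R := 𝕜) h))) = algebraMap 𝕜 H (counit h) := by
  apply (antipodeEquiv 𝕜 H).injective
  have h1 : ∀ z : H ⊗[𝕜] H, antipode 𝕜 (LinearMap.mul' 𝕜 H ((invAntipode 𝕜 H).lTensor H
      (TensorProduct.comm 𝕜 H H z))) =
      LinearMap.mul' 𝕜 H ((antipode 𝕜).lTensor H z) := by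
    intro z
    induction z with
    | zero => simp
    | add a b ha hb => simpa [map_add] using congr($ha + $hb)
    | tmul a b => simp [antipode_mul_antidistrib, antipode_invAntipode]
  refine (h1 _).trans ?_
  rw [mul_antipode_lTensor_comul_apply]
  change _ = antipode 𝕜 _
  rw [Algebra.algebraMap_eq_smul_one, map_smul, antipode_one]

instance : HopfAlgebra 𝕜 (Cop 𝕜 H) where
  antipode := (invAntipode 𝕜 H : H →ₗ[𝕜] H)
  mul_antipode_rTensor_comul := LinearMap.ext (invAntipode_cop_left 𝕜 H)
  mul_antipode_lTensor_comul := LinearMap.ext (invAntipode_cop_right 𝕜 H)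

instance : HasBijectiveAntipode 𝕜 (Cop 𝕜 H) where
  bijective := (antipodeEquiv 𝕜 H).symm.bijective

theorem invAntipode_toCop (h : H) :
    invAntipode 𝕜 (Cop 𝕜 H) (toCop 𝕜 H h) = toCop 𝕜 H (antipode 𝕜 h) := by
  apply (antipodeEquiv 𝕜 (Cop 𝕜 H)).injective
  refine (antipode_invAntipode (𝕜 := 𝕜) (H := Cop 𝕜 H) _).trans ?_
  exact (invAntipode_antipode h).symm

end Cop

section Double

variable (𝕜 : Type*) (H : Type*) [Field 𝕜] [Ring H] [HopfAlgebra 𝕜 H]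

open Coalgebra HopfAlgebra

/-- The dual algebra of the coalgebra `H`: its multiplication is the convolution product. -/
abbrev DualAlg : Type _ := WithConv (H →ₗ[𝕜] 𝕜)

/-- The iterated comultiplication `h ↦ h₁ ⊗ (h₂ ⊗ h₃)`. -/
def comul3 : H →ₗ[𝕜] H ⊗[𝕜] (H ⊗[𝕜] H) := (comul (R := 𝕜)).lTensor H ∘ₗ comul

theorem tensor3_induction {𝕜 : Type*} [Field 𝕜] {M : Type*} [AddCommGroup M] [Module 𝕜 M]
    {P : M ⊗[𝕜] (M ⊗[𝕜] M) → Prop} (h0 : P 0) (hadd : ∀ a b, P a → P b → P (a + b))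
    (ht : ∀ x y z : M, P (x ⊗ₜ (y ⊗ₜ z))) (w : M ⊗[𝕜] (M ⊗[𝕜] M)) : P w := by
  induction w with
  | zero => exact h0
  | add a b ha hb => exact hadd a b ha hb
  | tmul x w =>
    induction w with
    | zero => simpa using h0
    | add a b ha hb => rw [TensorProduct.tmul_add]; exact hadd _ _ ha hb
    | tmul y z => exact ht x y z

theorem comul3_one : comul3 𝕜 H 1 = 1 := by
  simp [comul3, Algebra.TensorProduct.one_def]

theorem comul3_mul (x y : H) : comul3 𝕜 H (x * y) = comul3 𝕜 H x * comul3 𝕜 H y :=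
  map_mul ((Algebra.TensorProduct.map (.id 𝕜 H) (Bialgebra.comulAlgHom 𝕜 H)).comp
    (Bialgebra.comulAlgHom 𝕜 H)) x y

/-- Left multiplication by `f ⋈ 1`, i.e. `g ⊗ k ↦ f g ⊗ k`. -/
def leftDual : DualAlg 𝕜 H →ₗ[𝕜] Module.End 𝕜 (DualAlg 𝕜 H ⊗[𝕜] H) :=
  LinearMap.rTensorHom H ∘ₗ LinearMap.mul 𝕜 (DualAlg 𝕜 H)

@[simp] theorem leftDual_tmul (f g : DualAlg 𝕜 H) (k : H) :
    leftDual 𝕜 H f (g ⊗ₜ k) = (f * g) ⊗ₜ k := rfl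

theorem comul3_assoc :
    TensorProduct.map comul (TensorProduct.map .id comul) ∘ₗ comul3 𝕜 H =
      (TensorProduct.assoc 𝕜 H H _).symm.toLinearMap ∘ₗ
        TensorProduct.map .id (TensorProduct.map .id (TensorProduct.assoc 𝕜 H H _).toLinearMap ∘ₗ
          (TensorProduct.assoc 𝕜 H (H ⊗[𝕜] H) H).toLinearMap ∘ₗ
          TensorProduct.map (comul3 𝕜 H) .id) ∘ₗ comul3 𝕜 H := by
  simp only [comul3, coassoc_simps]

variable [HasBijectiveAntipode 𝕜 H]

/-- The functional `u ↦ f (S⁻¹(q) * u * p)`, for `p q : H`. -/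
def coadjFun (p q : H) : DualAlg 𝕜 H →ₗ[𝕜] DualAlg 𝕜 H where
  toFun f := toConv (f.ofConv ∘ₗ LinearMap.mulRight 𝕜 p ∘ₗ
    LinearMap.mulLeft 𝕜 (invAntipode 𝕜 H q))
  map_add' _ _ := rfl
  map_smul' _ _ := rfl

theorem coadjFun_apply (p q : H) (f : DualAlg 𝕜 H) (u : H) :
    (coadjFun 𝕜 H p q f).ofConv u = f.ofConv (invAntipode 𝕜 H q * u * p) := rfl

theorem coadjFun_mul (p q p' q' : H) (f : DualAlg 𝕜 H) :
    coadjFun 𝕜 H (p * p') (q * q') f = coadjFun 𝕜 H p q (coadjFun 𝕜 H p' q' f) := by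
  ext u
  simp [coadjFun_apply, invAntipode_mul, mul_assoc]

/-- `coadjFun` as a bilinear map. -/
def coadj : H →ₗ[𝕜] H →ₗ[𝕜] DualAlg 𝕜 H →ₗ[𝕜] DualAlg 𝕜 H :=
  LinearMap.mk₂ 𝕜 (coadjFun 𝕜 H)
    (fun p p' q => by ext f u; simp [coadjFun_apply, mul_add])
    (fun c p q => by ext f u; simp [coadjFun_apply])
    (fun p q q' => by ext f u; simp [coadjFun_apply, add_mul])
    (fun c p q => by ext f u; simp [coadjFun_apply])

@[simp] theorem coadj_apply (p q : H) : coadj 𝕜 H p q = coadjFun 𝕜 H p q := rfl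

/-- `p ⊗ (m ⊗ q)` acts on `H* ⊗ H` by `g ⊗ k ↦ g (S⁻¹(q) ? p) ⊗ m k`. -/
def straighten : H ⊗[𝕜] (H ⊗[𝕜] H) →ₗ[𝕜] Module.End 𝕜 (DualAlg 𝕜 H ⊗[𝕜] H) :=
  TensorProduct.lift (LinearMap.mk₂ 𝕜
    (fun p z => TensorProduct.lift (((TensorProduct.mapBilinear (RingHom.id 𝕜) (DualAlg 𝕜 H) H
      (DualAlg 𝕜 H) H).compl₁₂ (coadj 𝕜 H p) (LinearMap.mul 𝕜 H)).flip) z)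
    (fun p p' z => by
      induction z with
      | zero => simp
      | add a b ha hb => rw [map_add, ha, hb, map_add, map_add]; abel
      | tmul m q => ext; simp)
    (fun c p z => by
      induction z with
      | zero => simp
      | add a b ha hb => simp only [map_add, ha, hb, smul_add]
      | tmul m q => ext; simp [TensorProduct.smul_tmul'])
    (fun p z z' => map_add _ z z')
    (fun c p z => map_smul _ c z))

@[simp] theorem straighten_tmul (p m q : H) (g : DualAlg 𝕜 H) (k : H) :
    straighten 𝕜 H (p ⊗ₜ (m ⊗ₜ q)) (g ⊗ₜ k) = coadjFun 𝕜 H p q g ⊗ₜ (m * k) := rfl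

theorem straighten_mul (w w' : H ⊗[𝕜] (H ⊗[𝕜] H)) :
    straighten 𝕜 H (w * w') = straighten 𝕜 H w * straighten 𝕜 H w' := by
  induction w using tensor3_induction with
  | h0 => simp
  | hadd a b ha hb => simp only [add_mul, map_add, ha, hb]
  | ht x y z =>
    induction w' using tensor3_induction with
    | h0 => simp
    | hadd a b ha hb => simp only [mul_add, map_add, ha, hb]
    | ht x' y' z' =>
      apply TensorProduct.ext'
      intro g k
      simp [coadjFun_mul, mul_assoc]

theorem straighten_one : straighten 𝕜 H 1 = 1 := by
  apply TensorProduct.ext'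
  intro g k
  have : coadjFun 𝕜 H 1 1 g = g := by
    ext u; simp [coadjFun_apply, invAntipode_one]
  change straighten 𝕜 H (1 ⊗ₜ (1 ⊗ₜ 1)) (g ⊗ₜ k) = g ⊗ₜ k
  simp [this]

/-- The operator `g ⊗ k ↦ ∑ g (S⁻¹(h₃) ? h₁) ⊗ h₂ k`: left multiplication by `ε ⋈ h`. -/
def leftH : H →ₗ[𝕜] Module.End 𝕜 (DualAlg 𝕜 H ⊗[𝕜] H) := straighten 𝕜 H ∘ₗ comul3 𝕜 H

theorem leftH_mul (x y : H) : leftH 𝕜 H (x * y) = leftH 𝕜 H x * leftH 𝕜 H y := by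
  simp [leftH, comul3_mul, straighten_mul]

theorem leftH_one : leftH 𝕜 H 1 = 1 := by
  simp [leftH, comul3_one, straighten_one]

/-- The multiplication of the Drinfeld double. -/
def doubleMul : DualAlg 𝕜 H ⊗[𝕜] H →ₗ[𝕜] Module.End 𝕜 (DualAlg 𝕜 H ⊗[𝕜] H) :=
  TensorProduct.lift ((LinearMap.mul 𝕜 (Module.End 𝕜 (DualAlg 𝕜 H ⊗[𝕜] H))).compl₁₂
    (leftDual 𝕜 H) (leftH 𝕜 H))

theorem doubleMul_tmul (f : DualAlg 𝕜 H) (h : H) :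
    doubleMul 𝕜 H (f ⊗ₜ h) = leftDual 𝕜 H f * leftH 𝕜 H h := rfl

theorem doubleMul_leftDual (f : DualAlg 𝕜 H) (z : DualAlg 𝕜 H ⊗[𝕜] H) :
    doubleMul 𝕜 H (leftDual 𝕜 H f z) = leftDual 𝕜 H f * doubleMul 𝕜 H z := by
  induction z with
  | zero => simp
  | add a b ha hb => simp only [map_add, ha, hb, mul_add]
  | tmul g k =>
    rw [leftDual_tmul, doubleMul_tmul, doubleMul_tmul, ← mul_assoc]
    congr 1
    apply TensorProduct.ext'
    intro a b
    simp [mul_assoc]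

theorem doubleMul_mulRight (k : H) (z : DualAlg 𝕜 H ⊗[𝕜] H) :
    doubleMul 𝕜 H ((LinearMap.mulRight 𝕜 k).lTensor _ z) =
      doubleMul 𝕜 H z * leftH 𝕜 H k := by
  induction z with
  | zero => simp
  | add a b ha hb => simp only [map_add, ha, hb, add_mul]
  | tmul g h => simp [doubleMul_tmul, leftH_mul, mul_assoc]

theorem straighten_mulRight (w : H ⊗[𝕜] (H ⊗[𝕜] H)) (g : DualAlg 𝕜 H) (k : H) :
    straighten 𝕜 H w (g ⊗ₜ k) =
      (LinearMap.mulRight 𝕜 k).lTensor _ (straighten 𝕜 H w (g ⊗ₜ 1)) := by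
  induction w using tensor3_induction with
  | h0 => simp
  | hadd a b ha hb => simp only [map_add, LinearMap.add_apply, ha, hb]
  | ht x y z => simp

/-- `(p₁, q₂) · g` times `(p₂, q₁) · a`, as a function of `Δ p` and `Δ q`. -/
def prodPair (g a : DualAlg 𝕜 H) : (H ⊗[𝕜] H) ⊗[𝕜] (H ⊗[𝕜] H) →ₗ[𝕜] DualAlg 𝕜 H :=
  LinearMap.mul' 𝕜 (DualAlg 𝕜 H) ∘ₗ
    TensorProduct.map (TensorProduct.lift ((coadj 𝕜 H).compr₂ (LinearMap.applyₗ g)))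
      (TensorProduct.lift ((coadj 𝕜 H).compr₂ (LinearMap.applyₗ a))) ∘ₗ
    (TensorProduct.tensorTensorTensorComm 𝕜 H H H H).toLinearMap ∘ₗ
    TensorProduct.map .id (TensorProduct.comm 𝕜 H H).toLinearMap

theorem prodPair_tmul (g a : DualAlg 𝕜 H) (p p' q q' : H) :
    prodPair 𝕜 H g a ((p ⊗ₜ p') ⊗ₜ (q ⊗ₜ q')) =
      coadjFun 𝕜 H p q' g * coadjFun 𝕜 H p' q a := rfl

theorem coadjFun_convMul (p q : H) (g a : DualAlg 𝕜 H) :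
    coadjFun 𝕜 H p q (g * a) = prodPair 𝕜 H g a (comul p ⊗ₜ comul q) := by
  ext u
  rw [coadjFun_apply]
  have h1 : ∀ x : H, (g * a).ofConv x = LinearMap.mul' 𝕜 𝕜
      (TensorProduct.map g.ofConv a.ofConv (comul x)) := fun x => rfl
  rw [h1, Bialgebra.comul_mul, Bialgebra.comul_mul, comul_invAntipode]
  generalize comul (R := 𝕜) p = P
  generalize comul (R := 𝕜) q = Q
  induction P with
  | zero => simp
  | add x y hx hy =>
    simp only [mul_add, map_add, TensorProduct.add_tmul, hx, hy]
    rfl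
  | tmul p p' =>
    induction Q with
    | zero => simp
    | add x y hx hy =>
      simp only [add_mul, map_add, TensorProduct.tmul_add, hx, hy]
      rfl
    | tmul q q' =>
      rw [prodPair_tmul]
      change _ = LinearMap.mul' 𝕜 𝕜 (TensorProduct.map (coadjFun 𝕜 H p q' g).ofConv
        (coadjFun 𝕜 H p' q a).ofConv (comul u))
      generalize comul (R := 𝕜) u = U
      induction U with
      | zero => simp
      | add x y hx hy => simp only [mul_add, add_mul, map_add, hx, hy]
      | tmul u u' => simp [coadjFun_apply]

/-- `(x₁ ⊗ x₂) ⊗ (x₃ ⊗ (x₄ ⊗ x₅)) ↦ ((x₁, x₅) · g) ((x₂, x₄) · a) ⊗ x₃ l`. -/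
def fiveMap (g a : DualAlg 𝕜 H) (l : H) :
    (H ⊗[𝕜] H) ⊗[𝕜] (H ⊗[𝕜] (H ⊗[𝕜] H)) →ₗ[𝕜] DualAlg 𝕜 H ⊗[𝕜] H :=
  TensorProduct.map (prodPair 𝕜 H g a) (LinearMap.mulRight 𝕜 l) ∘ₗ
    (TensorProduct.assoc 𝕜 _ _ _).symm.toLinearMap ∘ₗ
    TensorProduct.map .id (TensorProduct.comm 𝕜 _ _).toLinearMap

theorem leftH_mul_leftDual (h : H) (g : DualAlg 𝕜 H) :
    leftH 𝕜 H h * leftDual 𝕜 H g = doubleMul 𝕜 H (leftH 𝕜 H h (g ⊗ₜ 1)) := by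
  apply TensorProduct.ext'
  intro a l
  have key := congr(fiveMap 𝕜 H g a l $(LinearMap.congr_fun (comul3_assoc 𝕜 H) h))
  simp only [LinearMap.coe_comp, Function.comp_apply] at key
  simp only [leftH, Module.End.mul_apply, leftDual_tmul, LinearMap.coe_comp, Function.comp_apply]
  generalize comul3 𝕜 H h = w at *
  refine Eq.trans ?_ (key.trans ?_)
  · clear key
    induction w using tensor3_induction with
    | h0 => simp
    | hadd a b ha hb => simp only [map_add, LinearMap.add_apply, ha, hb]
    | ht x y z =>
      rw [straighten_tmul, coadjFun_convMul]
      rfl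
  · clear key
    induction w using tensor3_induction with
    | h0 => simp
    | hadd a b ha hb => simp only [map_add, LinearMap.add_apply, ha, hb]
    | ht x y z =>
      rw [straighten_tmul, mul_one, doubleMul_tmul]
      simp only [TensorProduct.map_tmul, LinearMap.id_apply, LinearMap.coe_comp,
        Function.comp_apply, Module.End.mul_apply, leftH]
      generalize comul3 𝕜 H y = v
      induction v using tensor3_induction with
      | h0 => simp
      | hadd a b ha hb => 
        simp only [map_add, LinearMap.add_apply, ha, hb, TensorProduct.add_tmul,
          TensorProduct.tmul_add]
      | ht x' y' z' => rfl

theorem doubleMul_assoc (w z : DualAlg 𝕜 H ⊗[𝕜] H) :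
    doubleMul 𝕜 H (doubleMul 𝕜 H w z) = doubleMul 𝕜 H w * doubleMul 𝕜 H z := by
  induction w with
  | zero => simp
  | add a b ha hb => simp only [map_add, LinearMap.add_apply, ha, hb, add_mul]
  | tmul f h =>
    induction z with
    | zero => simp
    | add a b ha hb => simp only [map_add, ha, hb, mul_add]
    | tmul g k =>
      rw [doubleMul_tmul, Module.End.mul_apply, doubleMul_leftDual, mul_assoc, doubleMul_tmul,
        ← mul_assoc (leftH 𝕜 H h), leftH_mul_leftDual]
      congr 1
      rw [← doubleMul_mulRight]
      congr 1
      exact straighten_mulRight 𝕜 H _ g k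

theorem doubleMul_one : doubleMul 𝕜 H (1 ⊗ₜ 1) = 1 := by
  rw [doubleMul_tmul, leftH_one, mul_one]
  apply TensorProduct.ext'
  intro a b
  simp

theorem counit_invAntipode (h : H) : counit (R := 𝕜) (invAntipode 𝕜 H h) = counit h := by
  rw [← HopfAlgebra.counit_antipode, antipode_invAntipode]

theorem coadjFun_one (p q : H) :
    coadjFun 𝕜 H p q 1 = (counit (R := 𝕜) p * counit (R := 𝕜) q) • 1 := by
  ext u
  rw [coadjFun_apply]
  change counit (R := 𝕜) _ = _ * counit (R := 𝕜) u
  simp only [Bialgebra.counit_mul, counit_invAntipode]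
  ring

theorem leftH_apply_one (h : H) : leftH 𝕜 H h (1 ⊗ₜ 1) = 1 ⊗ₜ h := by
  have h1 : ∀ w : H ⊗[𝕜] (H ⊗[𝕜] H), straighten 𝕜 H w (1 ⊗ₜ 1) =
      1 ⊗ₜ (TensorProduct.lid 𝕜 H (TensorProduct.map counit ((TensorProduct.rid 𝕜 H).toLinearMap ∘ₗ
        (counit (R := 𝕜)).lTensor H) w)) := by
    intro w
    induction w using tensor3_induction with
    | h0 => simp
    | hadd a b ha hb => simp only [map_add, LinearMap.add_apply, ha, hb, TensorProduct.tmul_add]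
    | ht x y z =>
      simp only [straighten_tmul, coadjFun_one, mul_one, TensorProduct.smul_tmul, mul_smul,
        TensorProduct.map_tmul, LinearMap.comp_apply, LinearMap.lTensor_tmul, LinearEquiv.coe_coe,
        TensorProduct.rid_tmul, TensorProduct.lid_tmul]
      rw [smul_comm]
  have h2 : TensorProduct.map (counit (R := 𝕜)) ((TensorProduct.rid 𝕜 H).toLinearMap ∘ₗ
      (counit (R := 𝕜)).lTensor H) (comul3 𝕜 H h) = 1 ⊗ₜ h := by
    rw [← Coalgebra.rTensor_counit_comul (R := 𝕜) h]
    simp only [comul3, LinearMap.comp_apply]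
    generalize comul (R := 𝕜) h = z
    induction z with
    | zero => simp
    | add a b ha hb => simp only [map_add, ha, hb]
    | tmul x y => simp
  simp [leftH, h1, h2]

theorem doubleMul_apply_one (w : DualAlg 𝕜 H ⊗[𝕜] H) : doubleMul 𝕜 H w (1 ⊗ₜ 1) = w := by
  induction w with
  | zero => simp
  | add a b ha hb => simp only [map_add, LinearMap.add_apply, ha, hb]
  | tmul f h => simp [doubleMul_tmul, leftH_apply_one]

/-- The Drinfeld double `D(H)`: the vector space `H* ⊗ H` with product
`(f ⋈ h)(g ⋈ k) = ∑ f g(S⁻¹(h₃) ? h₁) ⋈ h₂ k`, where `f` is multiplied by the functional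
`u ↦ g(S⁻¹(h₃) u h₁)` with the convolution product.  With the coadjoint actions
`(h ⇀ f)(u) = ∑ f(S⁻¹(h₂) u h₁)` and `h ↼ f = ∑ f(S⁻¹(h₃) h₁) h₂` this is the product
`∑ f (h₁ ⇀ g₂) ⋈ (h₂ ↼ g₁) k`, because `∑ h₂ S⁻¹(h₁) = ε(h) 1`. -/
def DrinfeldDouble : Type _ := DualAlg 𝕜 H ⊗[𝕜] H

instance : AddCommGroup (DrinfeldDouble 𝕜 H) :=
  inferInstanceAs (AddCommGroup (DualAlg 𝕜 H ⊗[𝕜] H))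

instance : Module 𝕜 (DrinfeldDouble 𝕜 H) :=
  inferInstanceAs (Module 𝕜 (DualAlg 𝕜 H ⊗[𝕜] H))

/-- The element `f ⋈ h` of the Drinfeld double. -/
def bowtie (f : DualAlg 𝕜 H) (h : H) : DrinfeldDouble 𝕜 H := f ⊗ₜ[𝕜] h

instance : Ring (DrinfeldDouble 𝕜 H) :=
  { (inferInstance : AddCommGroup (DrinfeldDouble 𝕜 H)) with
    mul := fun x y => doubleMul 𝕜 H x y
    one := bowtie 𝕜 H 1 1
    mul_assoc := fun x y z => LinearMap.congr_fun (doubleMul_assoc 𝕜 H x y) z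
    one_mul := fun x => LinearMap.congr_fun (doubleMul_one 𝕜 H) x
    mul_one := fun x => doubleMul_apply_one 𝕜 H x
    left_distrib := fun x y z => map_add (doubleMul 𝕜 H x) y z
    right_distrib := fun x y z => LinearMap.congr_fun (map_add (doubleMul 𝕜 H) x y) z
    zero_mul := fun x => LinearMap.congr_fun (map_zero (doubleMul 𝕜 H)) x
    mul_zero := fun x => map_zero (doubleMul 𝕜 H x) }

instance : Algebra 𝕜 (DrinfeldDouble 𝕜 H) :=
  Algebra.ofModule
    (fun c x y => LinearMap.congr_fun (map_smul (doubleMul 𝕜 H) c x) y)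
    (fun c x y => map_smul (doubleMul 𝕜 H x) c y)

theorem bowtie_mul_bowtie (f g : DualAlg 𝕜 H) (h k : H) :
    bowtie 𝕜 H f h * bowtie 𝕜 H g k =
      leftDual 𝕜 H f (straighten 𝕜 H (comul3 𝕜 H h) (g ⊗ₜ k)) := rfl

theorem DrinfeldDouble.one_def : (1 : DrinfeldDouble 𝕜 H) = bowtie 𝕜 H 1 1 := rfl

end Double

section HopfConstructor

open Coalgebra

theorem antipode_left_of_generators {𝕜 A : Type*} [Field 𝕜] [Ring A] [Bialgebra 𝕜 A]
    (S : A →ₐ[𝕜] Aᵐᵒᵖ) (s : Set A) (hs : Algebra.adjoin 𝕜 s = ⊤)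
    (h : ∀ x ∈ s, LinearMap.mul' 𝕜 A
      ((((MulOpposite.opLinearEquiv 𝕜).symm.toLinearMap ∘ₗ S.toLinearMap) : A →ₗ[𝕜] A).rTensor A
        (comul x)) = algebraMap 𝕜 A (counit x)) (x : A) :
    LinearMap.mul' 𝕜 A
      ((((MulOpposite.opLinearEquiv 𝕜).symm.toLinearMap ∘ₗ S.toLinearMap) : A →ₗ[𝕜] A).rTensor A
        (comul x)) = algebraMap 𝕜 A (counit x) := by
  set T : A →ₗ[𝕜] A := (MulOpposite.opLinearEquiv 𝕜).symm.toLinearMap ∘ₗ S.toLinearMap with hT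
  have hT1 : T 1 = 1 := by simp [hT]
  have hTm : ∀ a b, T (a * b) = T b * T a := fun a b => by simp [hT]
  have hx : x ∈ Algebra.adjoin 𝕜 s := hs ▸ Algebra.mem_top
  induction hx using Algebra.adjoin_induction with
  | mem x hx => exact h x hx
  | algebraMap r => simp [Algebra.TensorProduct.one_def, Algebra.algebraMap_eq_smul_one, hT1]
  | add x y _ _ hx hy => simp only [map_add, hx, hy]
  | mul x y _ _ hx hy =>
    have key : ∀ P Q : A ⊗[𝕜] A, ∀ c : 𝕜, LinearMap.mul' 𝕜 A (T.rTensor A P) = algebraMap 𝕜 A c →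
        LinearMap.mul' 𝕜 A (T.rTensor A (P * Q)) =
          algebraMap 𝕜 A c * LinearMap.mul' 𝕜 A (T.rTensor A Q) := by
      intro P Q c hP
      induction Q with
      | zero => simp
      | add a b ha hb => simp only [mul_add, map_add, ha, hb]
      | tmul a b =>
        have : ∀ P : A ⊗[𝕜] A, LinearMap.mul' 𝕜 A (T.rTensor A (P * (a ⊗ₜ b))) =
            T a * LinearMap.mul' 𝕜 A (T.rTensor A P) * b := by
          intro P
          induction P with
          | zero => simp
          | add u v hu hv => simp only [add_mul, mul_add, map_add, hu, hv]
          | tmul u v => simp [hTm, mul_assoc]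
        rw [this, hP]
        simp only [LinearMap.rTensor_tmul, LinearMap.mul'_apply]
        rw [← Algebra.commutes, mul_assoc]
    rw [Bialgebra.comul_mul, key _ _ _ hx, hy, Bialgebra.counit_mul, map_mul]

theorem antipode_right_of_generators {𝕜 A : Type*} [Field 𝕜] [Ring A] [Bialgebra 𝕜 A]
    (S : A →ₐ[𝕜] Aᵐᵒᵖ) (s : Set A) (hs : Algebra.adjoin 𝕜 s = ⊤)
    (h : ∀ x ∈ s, LinearMap.mul' 𝕜 A
      ((((MulOpposite.opLinearEquiv 𝕜).symm.toLinearMap ∘ₗ S.toLinearMap) : A →ₗ[𝕜] A).lTensor A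
        (comul x)) = algebraMap 𝕜 A (counit x)) (x : A) :
    LinearMap.mul' 𝕜 A
      ((((MulOpposite.opLinearEquiv 𝕜).symm.toLinearMap ∘ₗ S.toLinearMap) : A →ₗ[𝕜] A).lTensor A
        (comul x)) = algebraMap 𝕜 A (counit x) := by
  set T : A →ₗ[𝕜] A := (MulOpposite.opLinearEquiv 𝕜).symm.toLinearMap ∘ₗ S.toLinearMap with hT
  have hT1 : T 1 = 1 := by simp [hT]
  have hTm : ∀ a b, T (a * b) = T b * T a := fun a b => by simp [hT]
  have hx : x ∈ Algebra.adjoin 𝕜 s := hs ▸ Algebra.mem_top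
  induction hx using Algebra.adjoin_induction with
  | mem x hx => exact h x hx
  | algebraMap r => simp [Algebra.TensorProduct.one_def, Algebra.algebraMap_eq_smul_one, hT1]
  | add x y _ _ hx hy => simp only [map_add, hx, hy]
  | mul x y _ _ hx hy =>
    have key : ∀ P Q : A ⊗[𝕜] A, ∀ c : 𝕜, LinearMap.mul' 𝕜 A (T.lTensor A Q) = algebraMap 𝕜 A c →
        LinearMap.mul' 𝕜 A (T.lTensor A (P * Q)) =
          LinearMap.mul' 𝕜 A (T.lTensor A P) * algebraMap 𝕜 A c := by
      intro P Q c hQ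
      induction P with
      | zero => simp
      | add a b ha hb => simp only [add_mul, map_add, ha, hb]
      | tmul a b =>
        have : ∀ Q : A ⊗[𝕜] A, LinearMap.mul' 𝕜 A (T.lTensor A ((a ⊗ₜ b) * Q)) =
            a * LinearMap.mul' 𝕜 A (T.lTensor A Q) * T b := by
          intro Q
          induction Q with
          | zero => simp
          | add u v hu hv => simp only [add_mul, mul_add, map_add, hu, hv]
          | tmul u v => simp [hTm, mul_assoc]
        rw [this, hQ]
        simp only [LinearMap.lTensor_tmul, LinearMap.mul'_apply]
        rw [mul_assoc, Algebra.commutes, mul_assoc]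
    rw [Bialgebra.comul_mul, key _ _ _ hy, hx, Bialgebra.counit_mul, map_mul]

end HopfConstructor

section KAlgebra

/-- The four generators of the algebra `K`. -/
inductive KGen
  | a | b | c | d

open FreeAlgebra in
/-- The defining relations of the algebra `K`. -/
inductive KRel {𝕜 : Type*} [Field 𝕜] (ξ : 𝕜) : FreeAlgebra 𝕜 KGen → FreeAlgebra 𝕜 KGen → Prop
  | ab : KRel ξ (ι 𝕜 .a * ι 𝕜 .b) (ξ • (ι 𝕜 .b * ι 𝕜 .a))
  | ac : KRel ξ (ι 𝕜 .a * ι 𝕜 .c) (ξ • (ι 𝕜 .c * ι 𝕜 .a))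
  | cb : KRel ξ (ι 𝕜 .c * ι 𝕜 .b) 0
  | bc : KRel ξ (ι 𝕜 .b * ι 𝕜 .c) 0
  | cd : KRel ξ (ι 𝕜 .c * ι 𝕜 .d) (ξ • (ι 𝕜 .d * ι 𝕜 .c))
  | bd : KRel ξ (ι 𝕜 .b * ι 𝕜 .d) (ξ • (ι 𝕜 .d * ι 𝕜 .b))
  | ad_da : KRel ξ (ι 𝕜 .a * ι 𝕜 .d) (ι 𝕜 .d * ι 𝕜 .a)
  | ad : KRel ξ (ι 𝕜 .a * ι 𝕜 .d) 1
  | bb : KRel ξ (ι 𝕜 .b ^ 2) 0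
  | cc : KRel ξ (ι 𝕜 .c ^ 2) 0
  | aac : KRel ξ (ι 𝕜 .a ^ 2 * ι 𝕜 .c) (ι 𝕜 .b)
  | aaaa : KRel ξ (ι 𝕜 .a ^ 4) 1

/-- The algebra `K`, generated by `a, b, c, d` subject to `KRel`. -/
def KAlg {𝕜 : Type*} [Field 𝕜] {ξ : 𝕜} (_hξ : IsPrimitiveRoot ξ 4) : Type _ := RingQuot (KRel ξ)

variable {𝕜 : Type*} [Field 𝕜] {ξ : 𝕜} (hξ : IsPrimitiveRoot ξ 4)

namespace KAlg

instance : Ring (KAlg hξ) := inferInstanceAs (Ring (RingQuot (KRel ξ)))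

instance : Algebra 𝕜 (KAlg hξ) := inferInstanceAs (Algebra 𝕜 (RingQuot (KRel ξ)))

/-- The quotient map from the free algebra. -/
def proj : FreeAlgebra 𝕜 KGen →ₐ[𝕜] KAlg hξ := RingQuot.mkAlgHom 𝕜 (KRel ξ)

def gen (i : KGen) : KAlg hξ := proj hξ (FreeAlgebra.ι 𝕜 i)

def a : KAlg hξ := gen hξ .a
def b : KAlg hξ := gen hξ .b
def c : KAlg hξ := gen hξ .c
def d : KAlg hξ := gen hξ .d

variable {hξ}

theorem proj_eq_of_rel {x y : FreeAlgebra 𝕜 KGen} (h : KRel ξ x y) : proj hξ x = proj hξ y :=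
  RingQuot.mkAlgHom_rel 𝕜 h

theorem a_mul_b : a hξ * b hξ = ξ • (b hξ * a hξ) := by
  simpa [a, b, c, d, gen] using proj_eq_of_rel (hξ := hξ) KRel.ab
theorem a_mul_c : a hξ * c hξ = ξ • (c hξ * a hξ) := by
  simpa [a, b, c, d, gen] using proj_eq_of_rel (hξ := hξ) KRel.ac
theorem c_mul_b : c hξ * b hξ = 0 := by
  simpa [a, b, c, d, gen] using proj_eq_of_rel (hξ := hξ) KRel.cb
theorem b_mul_c : b hξ * c hξ = 0 := by
  simpa [a, b, c, d, gen] using proj_eq_of_rel (hξ := hξ) KRel.bc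
theorem c_mul_d : c hξ * d hξ = ξ • (d hξ * c hξ) := by
  simpa [a, b, c, d, gen] using proj_eq_of_rel (hξ := hξ) KRel.cd
theorem b_mul_d : b hξ * d hξ = ξ • (d hξ * b hξ) := by
  simpa [a, b, c, d, gen] using proj_eq_of_rel (hξ := hξ) KRel.bd
theorem a_mul_d : a hξ * d hξ = 1 := by
  simpa [a, b, c, d, gen] using proj_eq_of_rel (hξ := hξ) KRel.ad
theorem d_mul_a : d hξ * a hξ = 1 := by
  have h := a_mul_d (hξ := hξ)
  rw [← h]
  simpa [a, b, c, d, gen] using (proj_eq_of_rel (hξ := hξ) KRel.ad_da).symm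
theorem b_mul_b : b hξ * b hξ = 0 := by
  simpa [a, b, c, d, gen, sq] using proj_eq_of_rel (hξ := hξ) KRel.bb
theorem c_mul_c : c hξ * c hξ = 0 := by
  simpa [a, b, c, d, gen, sq] using proj_eq_of_rel (hξ := hξ) KRel.cc
theorem a_sq_mul_c : a hξ ^ 2 * c hξ = b hξ := by
  simpa [a, b, c, d, gen] using proj_eq_of_rel (hξ := hξ) KRel.aac
theorem a_pow_four : a hξ ^ 4 = 1 := by
  simpa [a, b, c, d, gen] using proj_eq_of_rel (hξ := hξ) KRel.aaaa

theorem xi_mul_xi (hξ : IsPrimitiveRoot ξ 4) : ξ * ξ = -1 := by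
  have h4 := hξ.pow_eq_one
  have h2 : ξ ^ 2 ≠ 1 := hξ.pow_ne_one_of_pos_of_lt (by norm_num) (by norm_num)
  have : (ξ ^ 2 - 1) * (ξ ^ 2 + 1) = 0 := by linear_combination h4
  rcases mul_eq_zero.1 this with h | h
  · exact absurd (sub_eq_zero.1 h) h2
  · linear_combination h

/-- The relations of `K` for four elements of an algebra. -/
structure IsKTuple (ξ : 𝕜) {A : Type*} [Ring A] [Algebra 𝕜 A] (a b c d : A) : Prop where
  ab : a * b = ξ • (b * a)
  ac : a * c = ξ • (c * a)
  cb : c * b = 0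
  bc : b * c = 0
  cd : c * d = ξ • (d * c)
  bd : b * d = ξ • (d * b)
  ad_da : a * d = d * a
  ad : a * d = 1
  bb : b ^ 2 = 0
  cc : c ^ 2 = 0
  aac : a ^ 2 * c = b
  aaaa : a ^ 4 = 1

/-- The universal property of `K`. -/
def lift {A : Type*} [Ring A] [Algebra 𝕜 A] {a' b' c' d' : A} (h : IsKTuple ξ a' b' c' d') :
    KAlg hξ →ₐ[𝕜] A :=
  RingQuot.liftAlgHom 𝕜 ⟨FreeAlgebra.lift 𝕜 (fun i => KGen.casesOn i a' b' c' d'), by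
    intro x y hxy
    cases hxy <;> simp only [map_mul, map_pow, map_smul, map_one, map_zero, FreeAlgebra.lift_ι_apply]
    exacts [h.ab, h.ac, h.cb, h.bc, h.cd, h.bd, h.ad_da, h.ad, h.bb, h.cc, h.aac, h.aaaa]⟩

section lift
variable {A : Type*} [Ring A] [Algebra 𝕜 A] {a' b' c' d' : A} (h : IsKTuple ξ a' b' c' d')

theorem lift_gen (i : KGen) :
    lift (hξ := hξ) h (gen hξ i) = KGen.casesOn (motive := fun _ => A) i a' b' c' d' := by
  simp only [lift, gen, proj]
  erw [RingQuot.liftAlgHom_mkAlgHom_apply]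
  simp

@[simp] theorem lift_a : lift h (a hξ) = a' := lift_gen h _
@[simp] theorem lift_b : lift h (b hξ) = b' := lift_gen h _
@[simp] theorem lift_c : lift h (c hξ) = c' := lift_gen h _
@[simp] theorem lift_d : lift h (d hξ) = d' := lift_gen h _

theorem algHom_ext {B : Type*} [Semiring B] [Algebra 𝕜 B] {f g : KAlg hξ →ₐ[𝕜] B}
    (ha : f (a hξ) = g (a hξ)) (hb : f (b hξ) = g (b hξ))
    (hc : f (c hξ) = g (c hξ)) (hd : f (d hξ) = g (d hξ)) : f = g := by
  refine RingQuot.ringQuot_ext' 𝕜 f g (FreeAlgebra.hom_ext ?_)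
  funext i
  cases i
  exacts [ha, hb, hc, hd]

end lift

theorem adjoin_gens : Algebra.adjoin 𝕜 ({a hξ, b hξ, c hξ, d hξ} : Set (KAlg hξ)) = ⊤ := by
  set S := Algebra.adjoin 𝕜 ({a hξ, b hξ, c hξ, d hξ} : Set (KAlg hξ)) with hS
  have hmem : ∀ x ∈ ({a hξ, b hξ, c hξ, d hξ} : Set (KAlg hξ)), x ∈ S :=
    fun x hx => Algebra.subset_adjoin hx
  have hT : IsKTuple ξ (⟨a hξ, hmem _ (by simp)⟩ : S) ⟨b hξ, hmem _ (by simp)⟩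
      ⟨c hξ, hmem _ (by simp)⟩ ⟨d hξ, hmem _ (by simp)⟩ := by
    constructor <;> apply Subtype.ext <;> simp
    exacts [a_mul_b, a_mul_c, c_mul_b, b_mul_c, c_mul_d, b_mul_d, a_mul_d.trans d_mul_a.symm,
      a_mul_d, by rw [sq, b_mul_b], by rw [sq, c_mul_c], a_sq_mul_c, a_pow_four]
  have : S.val.comp (lift (hξ := hξ) hT) = AlgHom.id 𝕜 _ := by
    apply algHom_ext <;> simp
  rw [eq_top_iff]
  intro x _
  have hx := AlgHom.congr_fun this x
  rw [← show _ = x from hx]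
  exact (lift (hξ := hξ) hT x).2

theorem d_mul_b : d hξ * b hξ = ξ • (c hξ * a hξ) := by
  rw [← a_mul_c, ← a_sq_mul_c, sq, mul_assoc, ← mul_assoc, d_mul_a, one_mul]

theorem a_sq_mul_b : a hξ ^ 2 * b hξ = c hξ := by
  rw [← a_sq_mul_c, ← mul_assoc, ← pow_add, a_pow_four, one_mul]

theorem d_mul_c : d hξ * c hξ = ξ • (b hξ * a hξ) := by
  rw [← a_mul_b, ← a_sq_mul_b, sq, mul_assoc, ← mul_assoc, d_mul_a, one_mul]

theorem a_sq_mul_d : a hξ ^ 2 * d hξ = a hξ := by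
  rw [sq, mul_assoc, a_mul_d, mul_one]

theorem a_sq_mul_a : a hξ ^ 2 * a hξ = d hξ := by
  calc a hξ ^ 2 * a hξ = a hξ ^ 2 * a hξ * (a hξ * d hξ) := by rw [a_mul_d, mul_one]
    _ = a hξ ^ 4 * d hξ := by noncomm_ring
    _ = d hξ := by rw [a_pow_four, one_mul]

theorem comul_tuple_sq : (a hξ ⊗ₜ[𝕜] a hξ + b hξ ⊗ₜ[𝕜] c hξ) ^ 2 = (a hξ ^ 2) ⊗ₜ[𝕜] (a hξ ^ 2) := by
  have := xi_mul_xi hξ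
  rw [sq, sq]
  simp [add_mul, mul_add, a_mul_b, a_mul_c, b_mul_b, c_mul_c, ← TensorProduct.smul_tmul', smul_smul,
    xi_mul_xi hξ]

theorem comul_tuple : IsKTuple ξ (a hξ ⊗ₜ[𝕜] a hξ + b hξ ⊗ₜ[𝕜] c hξ)
    (a hξ ⊗ₜ[𝕜] b hξ + b hξ ⊗ₜ[𝕜] d hξ) (c hξ ⊗ₜ[𝕜] a hξ + d hξ ⊗ₜ[𝕜] c hξ)
    (c hξ ⊗ₜ[𝕜] b hξ + d hξ ⊗ₜ[𝕜] d hξ) := by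
  have := xi_mul_xi hξ
  constructor
  case aac =>
    rw [comul_tuple_sq]
    simp [mul_add, a_sq_mul_c, a_sq_mul_d, a_sq_mul_a, add_comm]
  case aaaa =>
    rw [show 4 = 2 * 2 from rfl, pow_mul, comul_tuple_sq, Algebra.TensorProduct.tmul_pow,
      ← pow_mul, a_pow_four, Algebra.TensorProduct.one_def]
  all_goals
    simp [sq, add_mul, mul_add, a_mul_b, a_mul_c, b_mul_b, c_mul_c, b_mul_c, c_mul_b, b_mul_d,
      c_mul_d, a_mul_d, d_mul_a, d_mul_b, d_mul_c, smul_smul,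
      ← TensorProduct.smul_tmul', TensorProduct.neg_tmul, TensorProduct.tmul_neg,
      xi_mul_xi hξ, Algebra.TensorProduct.one_def, add_comm]

theorem counit_tuple : IsKTuple ξ (1 : 𝕜) 0 0 1 := by
  constructor <;> simp

theorem d_pow_four : d hξ ^ 4 = 1 := by
  have h : a hξ ^ 4 * d hξ ^ 4 = 1 := by
    calc a hξ ^ 4 * d hξ ^ 4 =
        a hξ * (a hξ * (a hξ * (a hξ * d hξ) * d hξ) * d hξ) * d hξ := by noncomm_ring
      _ = 1 := by simp only [a_mul_d, mul_one]
  rwa [a_pow_four, one_mul] at h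

theorem antipode_tuple : IsKTuple ξ (MulOpposite.op (d hξ)) (MulOpposite.op (ξ • b hξ))
    (MulOpposite.op (-ξ • c hξ)) (MulOpposite.op (a hξ)) := by
  have hx := xi_mul_xi hξ
  constructor <;> apply MulOpposite.unop_injective
  case aac => simp [sq, c_mul_d, smul_smul, hx, mul_assoc, d_mul_c, a_mul_d]
  case aaaa => simp [d_pow_four]
  all_goals
    simp [sq, b_mul_b, c_mul_c, b_mul_c, c_mul_b, b_mul_d, c_mul_d, a_mul_d, a_mul_b, a_mul_c,
      d_mul_a, smul_smul, hx]

/-- The bialgebra structure of `K`: `Δ(a) = a ⊗ a + b ⊗ c`, `Δ(b) = a ⊗ b + b ⊗ d`,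
`Δ(c) = c ⊗ a + d ⊗ c`, `Δ(d) = c ⊗ b + d ⊗ d`, `ε(a) = ε(d) = 1`, `ε(b) = ε(c) = 0`. -/
instance : Bialgebra 𝕜 (KAlg hξ) :=
  Bialgebra.ofAlgHom (lift comul_tuple) (lift counit_tuple)
    (by
      apply algHom_ext <;> simp [TensorProduct.add_tmul, TensorProduct.tmul_add] <;> abel)
    (by apply algHom_ext <;> simp)
    (by apply algHom_ext <;> simp)

theorem comul_eq (x : KAlg hξ) : Coalgebra.comul (R := 𝕜) x = lift (hξ := hξ) comul_tuple x := rfl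
theorem counit_eq (x : KAlg hξ) : Coalgebra.counit (R := 𝕜) x = lift (hξ := hξ) counit_tuple x :=
  rfl

/-- The antipode of `K`: the anti-homomorphism with `S(a) = d`, `S(b) = ξ b`, `S(c) = -ξ c`,
`S(d) = a`. -/
def antipodeOp : KAlg hξ →ₐ[𝕜] (KAlg hξ)ᵐᵒᵖ := lift antipode_tuple

instance : HopfAlgebra 𝕜 (KAlg hξ) where
  antipode := (MulOpposite.opLinearEquiv 𝕜).symm.toLinearMap ∘ₗ (antipodeOp (hξ := hξ)).toLinearMap
  mul_antipode_rTensor_comul := by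
    refine LinearMap.ext (antipode_left_of_generators _ _ adjoin_gens ?_)
    have hx := xi_mul_xi hξ
    rintro x (rfl | rfl | rfl | rfl) <;>
      simp [comul_eq, counit_eq, antipodeOp, a_mul_c, b_mul_c, c_mul_b, b_mul_d, a_mul_d, d_mul_a,
        d_mul_b, smul_smul, hx]
  mul_antipode_lTensor_comul := by
    refine LinearMap.ext (antipode_right_of_generators _ _ adjoin_gens ?_)
    have hx := xi_mul_xi hξ
    rintro x (rfl | rfl | rfl | rfl) <;>
      simp [comul_eq, counit_eq, antipodeOp, a_mul_b, b_mul_c, c_mul_b, c_mul_d, a_mul_d, d_mul_a,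
        d_mul_c, smul_smul, hx]

theorem antipode_eq (x : KAlg hξ) : HopfAlgebra.antipode 𝕜 x = (antipodeOp x).unop := rfl

/-- `S²` as an algebra map. -/
def antipodeSq : KAlg hξ →ₐ[𝕜] KAlg hξ :=
  AlgHom.ofLinearMap (HopfAlgebra.antipode 𝕜 ∘ₗ HopfAlgebra.antipode 𝕜)
    (by simp) (fun x y => by simp [HopfAlgebra.antipode_mul_antidistrib])

theorem antipodeSq_apply (x : KAlg hξ) :
    antipodeSq x = HopfAlgebra.antipode 𝕜 (HopfAlgebra.antipode 𝕜 x) := rfl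

theorem antipodeSq_antipodeSq (x : KAlg hξ) : antipodeSq (antipodeSq x) = x := by
  have h : (antipodeSq (hξ := hξ)).comp antipodeSq = AlgHom.id 𝕜 _ := by
    have hx := xi_mul_xi hξ
    apply algHom_ext <;>
      simp [antipodeSq_apply, antipode_eq, antipodeOp, smul_smul, hx]
  exact AlgHom.congr_fun h x

theorem antipode_bijective : Function.Bijective (HopfAlgebra.antipode 𝕜 (A := KAlg hξ)) := by
  constructor
  · intro x y hxy
    rw [← antipodeSq_antipodeSq x, ← antipodeSq_antipodeSq y]
    simp only [antipodeSq_apply, hxy]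
  · intro x
    exact ⟨_, antipodeSq_antipodeSq x⟩

theorem alpha_tuple (hξ : IsPrimitiveRoot ξ 4) : IsKTuple ξ ξ⁻¹ 0 0 ξ := by
  have h0 : ξ ≠ 0 := hξ.ne_zero (by norm_num)
  constructor <;> simp [h0, hξ.pow_eq_one]

/-- The algebra map `α₁ : K → 𝕜`. -/
def alpha (hξ : IsPrimitiveRoot ξ 4) : KAlg hξ →ₐ[𝕜] 𝕜 := lift (alpha_tuple hξ)

theorem skew_tuple (hξ : IsPrimitiveRoot ξ 4) (t : 𝕜) :
    IsKTuple ξ (!![1, 0; 0, ξ⁻¹] : Matrix (Fin 2) (Fin 2) 𝕜) !![0, t; 0, 0] !![0, t; 0, 0]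
      !![1, 0; 0, ξ] := by
  have h0 : ξ ≠ 0 := hξ.ne_zero (by norm_num)
  have hx := xi_mul_xi hξ
  have h5 : ξ * ξ * ξ * ξ = 1 := by rw [hx]; simp [hx]
  have h6 : ξ⁻¹ = -ξ := by
    field_simp
    linear_combination hx
  constructor <;> ext i j <;> fin_cases i <;> fin_cases j <;>
    simp [pow_succ, Matrix.mul_apply, Fin.sum_univ_two, h0]
  · rw [h6]; linear_combination t * hx
  · rw [h6]; linear_combination t * hx
  · ring
  · ring
  · rw [h6]; linear_combination h5

/-- The matrix representation `u ↦ !![ε(u), x(u); 0, α₁(u)]` of `K`, where `x` is the linear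
functional with `x(u v) = ε(u) x(v) + x(u) α₁(v)`, `x(a) = x(d) = 0` and `x(b) = x(c) = t`. -/
def skewRep (hξ : IsPrimitiveRoot ξ 4) (t : 𝕜) : KAlg hξ →ₐ[𝕜] Matrix (Fin 2) (Fin 2) 𝕜 :=
  lift (skew_tuple hξ t)

/-- The linear functional on `K` with value `s ξ` on `b, c, ab, ac` and `0` on `1, a, d, a²`. -/
def skewPrim (hξ : IsPrimitiveRoot ξ 4) (s : 𝕜) : KAlg hξ →ₗ[𝕜] 𝕜 :=
  Matrix.entryLinearMap 𝕜 𝕜 0 1 ∘ₗ (skewRep hξ (s * ξ)).toLinearMap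

theorem skewPrim_values (hξ : IsPrimitiveRoot ξ 4) (s : 𝕜) :
    skewPrim hξ s 1 = 0 ∧ skewPrim hξ s (a hξ) = 0 ∧ skewPrim hξ s (b hξ) = s * ξ ∧
      skewPrim hξ s (c hξ) = s * ξ ∧ skewPrim hξ s (d hξ) = 0 ∧ skewPrim hξ s (a hξ ^ 2) = 0 ∧
      skewPrim hξ s (a hξ * b hξ) = s * ξ ∧ skewPrim hξ s (a hξ * c hξ) = s * ξ := by
  simp [skewPrim, skewRep, sq]

instance : HasBijectiveAntipode 𝕜 (KAlg hξ) := ⟨antipode_bijective⟩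

end KAlg

/-- The Drinfeld double `D = D(K^cop)`. -/
abbrev DK {𝕜 : Type*} [Field 𝕜] {ξ : 𝕜} (hξ : IsPrimitiveRoot ξ 4) : Type _ :=
  DrinfeldDouble 𝕜 (Cop 𝕜 (KAlg hξ))

namespace DK

/-- The element `ε ⋈ u` of `D`, for `u : K`. -/
def ofK (u : KAlg hξ) : DK hξ := bowtie 𝕜 (Cop 𝕜 (KAlg hξ)) 1 (toCop 𝕜 (KAlg hξ) u)

/-- The element `f ⋈ 1` of `D`, for a linear functional `f` on `K`. -/
def ofDual (f : KAlg hξ →ₗ[𝕜] 𝕜) : DK hξ :=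
  bowtie 𝕜 (Cop 𝕜 (KAlg hξ)) (toConv (f ∘ₗ (toCop 𝕜 (KAlg hξ)).symm.toLinearMap)) 1

def a : DK hξ := ofK hξ (KAlg.a hξ)
def b : DK hξ := ofK hξ (KAlg.b hξ)
def c : DK hξ := ofK hξ (KAlg.c hξ)
def d : DK hξ := ofK hξ (KAlg.d hξ)

/-- The element `g = α₁ ⋈ 1` of `D`. -/
def g : DK hξ := ofDual hξ (KAlg.alpha hξ).toLinearMap

/-- The element `x = s ξ (b* + c* + (ab)* + (ac)*) ⋈ 1` of `D`, where `s² = 2`. -/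
def x (s : 𝕜) : DK hξ := ofDual hξ (KAlg.skewPrim hξ s)

end DK
end KAlgebra

section Modules

/-- The left `A`-module with underlying space `V` given by a representation of `A` on `V`. -/
def RepModule {𝕜 A V : Type*} [Field 𝕜] [Ring A] [Algebra 𝕜 A] [AddCommGroup V] [Module 𝕜 V]
    (_φ : A →ₐ[𝕜] Module.End 𝕜 V) : Type _ := V

variable {𝕜 A V : Type*} [Field 𝕜] [Ring A] [Algebra 𝕜 A] [AddCommGroup V] [Module 𝕜 V]

instance (φ : A →ₐ[𝕜] Module.End 𝕜 V) : AddCommGroup (RepModule φ) :=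
  inferInstanceAs (AddCommGroup V)

instance (φ : A →ₐ[𝕜] Module.End 𝕜 V) : Module 𝕜 (RepModule φ) :=
  inferInstanceAs (Module 𝕜 V)

instance (φ : A →ₐ[𝕜] Module.End 𝕜 V) : Module A (RepModule φ) :=
  Module.compHom V φ.toRingHom

theorem RepModule.smul_def (φ : A →ₐ[𝕜] Module.End 𝕜 V) (x : A) (v : RepModule φ) :
    x • v = (φ x : V →ₗ[𝕜] V) v := rfl

instance (φ : A →ₐ[𝕜] Module.End 𝕜 V) : IsScalarTower 𝕜 A (RepModule φ) where
  smul_assoc r x v := by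
    rw [RepModule.smul_def, RepModule.smul_def, map_smul]
    rfl

/-- The one-dimensional module `𝕜_χ` of a character `χ`. -/
abbrev CharModule (χ : A →ₐ[𝕜] 𝕜) : Type _ := RepModule ((Algebra.lmul 𝕜 𝕜).comp χ)

/-- The module of column vectors of a matrix representation `ρ`. -/
abbrev MatModule {n : ℕ} (ρ : A →ₐ[𝕜] Matrix (Fin n) (Fin n) 𝕜) : Type _ :=
  RepModule ((Matrix.toLinAlgEquiv' (R := 𝕜) (n := Fin n)).toAlgHom.comp ρ)

end Modules

section Statement

/-- The index set `Λ = {(i, j) ∈ ℤ/4 × ℤ/4 : 2 i ≠ j}`. -/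
abbrev Lam : Type := {p : ZMod 4 × ZMod 4 // 2 * p.1 ≠ p.2}

variable {𝕜 : Type*} [Field 𝕜] {ξ : 𝕜}

/-- `ξ ^ n` for an exponent `n` modulo `4`. -/
def xiPow (ξ : 𝕜) (n : ZMod 4) : 𝕜 := ξ ^ n.val

/-- The values of the character `χ^j` on the generators of `D`. -/
structure HasCharValues (hξ : IsPrimitiveRoot ξ 4) (s : 𝕜) (j : ZMod 4) (χ : DK hξ →ₐ[𝕜] 𝕜) :
    Prop where
  a : χ (DK.a hξ) = xiPow ξ j
  b : χ (DK.b hξ) = 0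
  c : χ (DK.c hξ) = 0
  d : χ (DK.d hξ) = xiPow ξ (-j)
  x : χ (DK.x hξ s) = 0
  g : χ (DK.g hξ) = (-1) ^ j.val

/-- The matrices of the generators of `D` on the module `V_{i,j}`. -/
structure HasMatrixValues (hξ : IsPrimitiveRoot ξ 4) (s : 𝕜) (i j : ZMod 4)
    (ρ : DK hξ →ₐ[𝕜] Matrix (Fin 2) (Fin 2) 𝕜) : Prop where
  a : ρ (DK.a hξ) = !![xiPow ξ i, 0; 0, xiPow ξ (i + 3)]
  b : ρ (DK.b hξ) = !![0, (-1) ^ i.val; 0, 0]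
  c : ρ (DK.c hξ) = !![0, 1; 0, 0]
  d : ρ (DK.d hξ) = !![xiPow ξ (-i), 0; 0, xiPow ξ (-i + 1)]
  g : ρ (DK.g hξ) = !![xiPow ξ j, 0; 0, xiPow ξ (j + 2)]
  x : ρ (DK.x hξ s) = !![0, s / 2 * ξ * (xiPow ξ i + xiPow ξ (3 * i + j));
    s * ξ * (xiPow ξ (3 * i) - xiPow ξ (i + j)), 0]

/-- The modules `𝕜_{χ^j}` (for `j ∈ ℤ/4`) and `V_{i,j}` (for `(i, j) ∈ Λ`) as a single family. -/
def simpleFamily {𝕜 : Type u} [Field 𝕜] {ξ : 𝕜} (hξ : IsPrimitiveRoot ξ 4)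
    (χ : ZMod 4 → (DK hξ →ₐ[𝕜] 𝕜)) (ρ : Lam → (DK hξ →ₐ[𝕜] Matrix (Fin 2) (Fin 2) 𝕜)) :
    ZMod 4 ⊕ Lam → ModuleCat.{u} (DK hξ)
  | .inl j => ModuleCat.of (DK hξ) (CharModule (χ j))
  | .inr p => ModuleCat.of (DK hξ) (MatModule (ρ p))

end Statement

end

noncomputable section

/-! ### A spanning set of `K` -/

namespace KAlg

variable {𝕜 : Type*} [Field 𝕜] {ξ : 𝕜} {hξ : IsPrimitiveRoot ξ 4}

/-! The simple modules are classified by highest weights. A highest weight vector of weight `(i, j)`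
is killed by `c`, and `a` and `g` act on it by `ξ^i` and `ξ^j`. Every nonzero module has a nonzero
one: `c² = 0` makes the kernel of `c` nonzero, `a` and `g` preserve that kernel and commute, and `a⁴
= g⁴ = 1` splits over the powers of `ξ` (`DK.exists_isHighestWeight`).

As a vector space `D` is the dual of `K` times `K`. Here `K` is generated by `a` and `c`, and the
dual has the basis `x^e g^k` with `e < 2`, `k < 4`. Hence a highest weight vector `v` generates the
span of `v` and `x v` (`smul_eq`). The commutation of `c` with `x` gives `c x v = s ξ (ξ^{3i} -
ξ^{i+j}) v`, whose coefficient vanishes exactly when `2i = j`.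

If `2i ≠ j`, the vector `v` is recovered from `x v`. If `2i = j`, then `x v` is again killed by `c`,
has a different weight, and `x x v = (g² - 1) v = 0`; so simplicity forces `x v = 0`. In both cases
the kernel of `c` in a simple module is the line through `v` (`eq_smul`), so the weight is an
invariant. The annihilator of `v` depends only on the weight, so it is a complete invariant
(`nonempty_equiv`). The `χ^j` realise the weights `(j, 2j)` and the `V_{i,j}` the remaining ones,
hence all sixteen.

To see that these modules exist, one glues a representation of `K` and one of the dual algebra. By
`exists_lift` they combine to a representation of `D` once the exchange relations hold between `a,
b, c, d` and `g, x`. The representations of the dual are evaluations at grouplike elements or at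
multiplicative `2 × 2` matrices over `K`, so no presentation of the dual is required. -/

theorem xi_inv (hξ : IsPrimitiveRoot ξ 4) : ξ⁻¹ = -ξ :=
  inv_eq_of_mul_eq_one_right (by rw [mul_neg, xi_mul_xi hξ, neg_neg])

variable (hξ) in
/-- The basis `1, a, a², d, b, c, ab, ac` of `K`. -/
def basisVec : Fin 8 → KAlg hξ :=
  ![1, a hξ, a hξ ^ 2, d hξ, b hξ, c hξ, a hξ * b hξ, a hξ * c hξ]

theorem a_mul_a_sq : a hξ * a hξ ^ 2 = d hξ := by
  rw [← a_sq_mul_a, ← pow_succ', ← pow_succ]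

theorem a_mul_a_mul (u : KAlg hξ) : a hξ * (a hξ * u) = a hξ ^ 2 * u := by
  rw [sq, mul_assoc]

theorem a_mul_basisVec (i : Fin 8) : a hξ * basisVec hξ i ∈ Set.range (basisVec hξ) := by
  fin_cases i
  · exact ⟨1, by simp [basisVec]⟩
  · exact ⟨2, by simp [basisVec, sq]⟩
  · exact ⟨3, by simp [basisVec, a_mul_a_sq]⟩
  · exact ⟨0, by simp [basisVec, a_mul_d]⟩
  · exact ⟨6, by simp [basisVec]⟩
  · exact ⟨7, by simp [basisVec]⟩
  · exact ⟨5, by simp [basisVec, a_mul_a_mul, a_sq_mul_b]⟩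
  · exact ⟨4, by simp [basisVec, a_mul_a_mul, a_sq_mul_c]⟩

theorem c_mul_a (hξ : IsPrimitiveRoot ξ 4) : c hξ * a hξ = -ξ • (a hξ * c hξ) := by
  rw [a_mul_c, smul_smul, neg_mul, xi_mul_xi hξ, neg_neg, one_smul]

theorem c_mul_a_sq : c hξ * a hξ ^ 2 = -b hξ := by
  rw [sq, ← mul_assoc, c_mul_a, smul_mul_assoc, mul_assoc, c_mul_a, mul_smul_comm, smul_smul,
    neg_mul_neg, xi_mul_xi hξ, a_mul_a_mul, a_sq_mul_c, neg_one_smul]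

theorem c_mul_basisVec (i : Fin 8) :
    c hξ * basisVec hξ i ∈ Submodule.span 𝕜 (Set.range (basisVec hξ)) := by
  have h (j) : basisVec hξ j ∈ Submodule.span 𝕜 (Set.range (basisVec hξ)) :=
    Submodule.subset_span ⟨j, rfl⟩
  fin_cases i
  · simpa [basisVec] using h 5
  · simpa [basisVec, c_mul_a] using Submodule.smul_mem _ ξ (h 7)
  · simpa [basisVec, c_mul_a_sq] using h 4
  · simpa [basisVec, c_mul_d, d_mul_c, a_mul_b, smul_smul, xi_mul_xi hξ] using
      Submodule.smul_mem _ ξ (h 6)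
  · simp [basisVec, c_mul_b]
  · simp [basisVec, c_mul_c]
  · simp [basisVec, ← mul_assoc, c_mul_a]
    simp [mul_assoc, c_mul_b]
  · simp [basisVec, ← mul_assoc, c_mul_a]
    simp [mul_assoc, c_mul_c]

/-- The other two generators are `b = a² c` and `d = a³`. -/
theorem adjoin_a_c : Algebra.adjoin 𝕜 {a hξ, c hξ} = ⊤ := by
  have ha : a hξ ∈ Algebra.adjoin 𝕜 {a hξ, c hξ} := Algebra.subset_adjoin (by simp)
  have hc : c hξ ∈ Algebra.adjoin 𝕜 {a hξ, c hξ} := Algebra.subset_adjoin (by simp)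
  rw [eq_top_iff, ← adjoin_gens, Algebra.adjoin_le_iff]
  rintro x (rfl | rfl | rfl | rfl)
  · exact ha
  · rw [← a_sq_mul_c]; exact mul_mem (pow_mem ha 2) hc
  · exact hc
  · rw [← a_sq_mul_a]; exact mul_mem (pow_mem ha 2) ha

/-- The span contains `1` and is stable under left multiplication by `a` and `c`, which generate
`K`; so it is a left ideal containing `1`. -/
theorem span_basisVec : Submodule.span 𝕜 (Set.range (basisVec hξ)) = ⊤ := by
  set S := Submodule.span 𝕜 (Set.range (basisVec hξ))
  have ha : ∀ z ∈ S, a hξ * z ∈ S := fun z hz => by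
    have : S ≤ S.comap (LinearMap.mulLeft 𝕜 (a hξ)) :=
      Submodule.span_le.2 (by rintro _ ⟨i, rfl⟩; exact Submodule.subset_span (a_mul_basisVec i))
    exact this hz
  have hc : ∀ z ∈ S, c hξ * z ∈ S := fun z hz => by
    have : S ≤ S.comap (LinearMap.mulLeft 𝕜 (c hξ)) :=
      Submodule.span_le.2 (by rintro _ ⟨i, rfl⟩; exact c_mul_basisVec i)
    exact this hz
  rw [eq_top_iff]
  rintro y -
  have hy : y ∈ Algebra.adjoin 𝕜 {a hξ, c hξ} := by rw [adjoin_a_c]; exact Algebra.mem_top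
  suffices h : ∀ z ∈ S, y * z ∈ S by
    simpa using h 1 (Submodule.subset_span ⟨0, rfl⟩)
  induction hy using Algebra.adjoin_induction with
  | mem x hx =>
    rcases hx with rfl | rfl
    exacts [ha, hc]
  | algebraMap r => intro z hz; rw [← Algebra.smul_def]; exact S.smul_mem r hz
  | add x y _ _ hx hy => intro z hz; rw [add_mul]; exact S.add_mem (hx z hz) (hy z hz)
  | mul x y _ _ hx hy => intro z hz; rw [mul_assoc]; exact hx _ (hy z hz)

theorem linearMap_ext {V : Type*} [AddCommGroup V] [Module 𝕜 V] {f g : KAlg hξ →ₗ[𝕜] V}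
    (h1 : f 1 = g 1) (ha : f (a hξ) = g (a hξ)) (ha2 : f (a hξ ^ 2) = g (a hξ ^ 2))
    (hd : f (d hξ) = g (d hξ)) (hb : f (b hξ) = g (b hξ)) (hc : f (c hξ) = g (c hξ))
    (hab : f (a hξ * b hξ) = g (a hξ * b hξ)) (hac : f (a hξ * c hξ) = g (a hξ * c hξ)) :
    f = g := by
  refine LinearMap.ext_on_range span_basisVec fun i => ?_
  fin_cases i
  exacts [h1, ha, ha2, hd, hb, hc, hab, hac]

/-! ### Coproducts of the basis and evaluation of functionals -/

section comul
open Coalgebra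

theorem comul_a : comul (R := 𝕜) (a hξ) = a hξ ⊗ₜ a hξ + b hξ ⊗ₜ c hξ := by simp [comul_eq]
theorem comul_b : comul (R := 𝕜) (b hξ) = a hξ ⊗ₜ b hξ + b hξ ⊗ₜ d hξ := by simp [comul_eq]
theorem comul_c : comul (R := 𝕜) (c hξ) = c hξ ⊗ₜ a hξ + d hξ ⊗ₜ c hξ := by simp [comul_eq]
theorem comul_d : comul (R := 𝕜) (d hξ) = c hξ ⊗ₜ b hξ + d hξ ⊗ₜ d hξ := by simp [comul_eq]
theorem comul_a_sq : comul (R := 𝕜) (a hξ ^ 2) = (a hξ ^ 2) ⊗ₜ (a hξ ^ 2) := by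
  rw [comul_eq, map_pow, lift_a, comul_tuple_sq]
theorem comul_a_mul_c :
    comul (R := 𝕜) (a hξ * c hξ) = (a hξ * c hξ) ⊗ₜ (a hξ ^ 2) + 1 ⊗ₜ (a hξ * c hξ) := by
  rw [Bialgebra.comul_mul, comul_a, comul_c]
  simp [add_mul, mul_add, a_mul_d, b_mul_c, c_mul_c, sq]
theorem comul_a_mul_b :
    comul (R := 𝕜) (a hξ * b hξ) = (a hξ * b hξ) ⊗ₜ 1 + (a hξ ^ 2) ⊗ₜ (a hξ * b hξ) := by
  rw [Bialgebra.comul_mul, comul_a, comul_b]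
  simp [add_mul, mul_add, b_mul_b, c_mul_b, sq, a_mul_d, add_comm]

@[simp] theorem counit_a : counit (R := 𝕜) (a hξ) = 1 := by simp [counit_eq]
@[simp] theorem counit_b : counit (R := 𝕜) (b hξ) = 0 := by simp [counit_eq]
@[simp] theorem counit_c : counit (R := 𝕜) (c hξ) = 0 := by simp [counit_eq]
@[simp] theorem counit_d : counit (R := 𝕜) (d hξ) = 1 := by simp [counit_eq]

end comul

/-- The dual algebra of the coalgebra underlying `K^cop`. -/
abbrev Dual (hξ : IsPrimitiveRoot ξ 4) : Type _ := DualAlg 𝕜 (Cop 𝕜 (KAlg hξ))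

variable (hξ) in
/-- A linear functional on `K` as an element of the dual algebra of `K^cop`. -/
def toDual : (KAlg hξ →ₗ[𝕜] 𝕜) ≃ₗ[𝕜] Dual hξ :=
  ((toCop 𝕜 (KAlg hξ)).toLinearEquiv.arrowCongr (LinearEquiv.refl 𝕜 𝕜)).trans
    (WithConv.linearEquiv 𝕜 _).symm

/-- Evaluation of an element of the dual algebra of `K^cop` on `K`. -/
def ev (f : Dual hξ) : KAlg hξ →ₗ[𝕜] 𝕜 := (toDual hξ).symm f

@[simp] theorem ev_toDual (f : KAlg hξ →ₗ[𝕜] 𝕜) : ev (toDual hξ f) = f :=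
  (toDual hξ).symm_apply_apply f
theorem ev_apply (f : Dual hξ) (u : KAlg hξ) : ev f u = f.ofConv (toCop 𝕜 _ u) := rfl
@[simp] theorem ev_add (f g : Dual hξ) : ev (f + g) = ev f + ev g := rfl
@[simp] theorem ev_sub (f g : Dual hξ) : ev (f - g) = ev f - ev g := rfl
@[simp] theorem ev_neg (f : Dual hξ) : ev (-f) = -ev f := rfl
@[simp] theorem ev_smul (r : 𝕜) (f : Dual hξ) : ev (r • f) = r • ev f := rfl

theorem ev_one (u : KAlg hξ) : ev (1 : Dual hξ) u = Coalgebra.counit (R := 𝕜) u := rfl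

/-- Convolution is taken with respect to the flipped coproduct of `K^cop`; written with the
coproduct of `K`, the second factor therefore meets the first leg. -/
theorem ev_mul (f g : Dual hξ) (u : KAlg hξ) :
    ev (f * g) u = LinearMap.mul' 𝕜 𝕜
      (TensorProduct.map (ev g) (ev f) (Coalgebra.comul (R := 𝕜) u)) := by
  have : ev (f * g) u = LinearMap.mul' 𝕜 𝕜 (TensorProduct.map (ev f) (ev g)
    (TensorProduct.comm 𝕜 _ _ (Coalgebra.comul (R := 𝕜) u))) := rfl
  rw [this]
  generalize Coalgebra.comul (R := 𝕜) u = z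
  induction z with
  | zero => simp
  | add x y hx hy => simp only [map_add, hx, hy]
  | tmul x y => simp [mul_comm]

theorem ev_injective : Function.Injective (ev (hξ := hξ)) := (toDual hξ).symm.injective

variable (f g : Dual hξ)
theorem ev_mul_one : ev (f * g) 1 = ev f 1 * ev g 1 := by
  simp [ev_mul, Algebra.TensorProduct.one_def, mul_comm]
theorem ev_mul_a : ev (f * g) (a hξ) = ev f (a hξ) * ev g (a hξ) + ev f (c hξ) * ev g (b hξ) := by
  simp [ev_mul, comul_a, mul_comm]
theorem ev_mul_b : ev (f * g) (b hξ) = ev f (b hξ) * ev g (a hξ) + ev f (d hξ) * ev g (b hξ) := by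
  simp [ev_mul, comul_b, mul_comm]
theorem ev_mul_c : ev (f * g) (c hξ) = ev f (a hξ) * ev g (c hξ) + ev f (c hξ) * ev g (d hξ) := by
  simp [ev_mul, comul_c, mul_comm]
theorem ev_mul_d : ev (f * g) (d hξ) = ev f (b hξ) * ev g (c hξ) + ev f (d hξ) * ev g (d hξ) := by
  simp [ev_mul, comul_d, mul_comm]
theorem ev_mul_a_sq : ev (f * g) (a hξ ^ 2) = ev f (a hξ ^ 2) * ev g (a hξ ^ 2) := by
  rw [ev_mul, comul_a_sq]; simp [mul_comm]
theorem ev_mul_a_mul_b : ev (f * g) (a hξ * b hξ) =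
    ev f 1 * ev g (a hξ * b hξ) + ev f (a hξ * b hξ) * ev g (a hξ ^ 2) := by
  rw [ev_mul, comul_a_mul_b]; simp [mul_comm, add_comm]
theorem ev_mul_a_mul_c : ev (f * g) (a hξ * c hξ) =
    ev f (a hξ ^ 2) * ev g (a hξ * c hξ) + ev f (a hξ * c hξ) * ev g 1 := by
  rw [ev_mul, comul_a_mul_c]; simp [mul_comm, add_comm]

variable (hξ) in
/-- The character `α₁` of `K` as an element of the dual algebra. -/
def gDual : Dual hξ := toDual hξ (alpha hξ).toLinearMap

variable (hξ) in
/-- The functional `θ` as an element of the dual algebra. -/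
def xDual (s : 𝕜) : Dual hξ := toDual hξ (skewPrim hξ s)

@[simp] theorem alpha_a : alpha hξ (a hξ) = -ξ := by simp [alpha, xi_inv hξ]
@[simp] theorem alpha_b : alpha hξ (b hξ) = 0 := by simp [alpha]
@[simp] theorem alpha_c : alpha hξ (c hξ) = 0 := by simp [alpha]
@[simp] theorem alpha_d : alpha hξ (d hξ) = ξ := by simp [alpha]

@[simp] theorem ev_gDual (u : KAlg hξ) : ev (gDual hξ) u = alpha hξ u := by simp [gDual]
@[simp] theorem ev_xDual (s : 𝕜) : ev (xDual hξ s) = skewPrim hξ s := by simp [xDual]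

theorem dual_ext {f g : Dual hξ}
    (h1 : ev f 1 = ev g 1) (ha : ev f (a hξ) = ev g (a hξ))
    (ha2 : ev f (a hξ ^ 2) = ev g (a hξ ^ 2))
    (hd : ev f (d hξ) = ev g (d hξ)) (hb : ev f (b hξ) = ev g (b hξ))
    (hc : ev f (c hξ) = ev g (c hξ)) (hab : ev f (a hξ * b hξ) = ev g (a hξ * b hξ))
    (hac : ev f (a hξ * c hξ) = ev g (a hξ * c hξ)) : f = g :=
  ev_injective (linearMap_ext h1 ha ha2 hd hb hc hab hac)

end KAlg

/-! ### Relations and bases in the dual algebra; the dimension of `D` -/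

namespace KAlg

variable {𝕜 : Type*} [Field 𝕜] {ξ : 𝕜} {hξ : IsPrimitiveRoot ξ 4}

@[simp] theorem skewPrim_one (s : 𝕜) : skewPrim hξ s 1 = 0 := (skewPrim_values hξ s).1
@[simp] theorem skewPrim_a (s : 𝕜) : skewPrim hξ s (a hξ) = 0 := (skewPrim_values hξ s).2.1
@[simp] theorem skewPrim_b (s : 𝕜) : skewPrim hξ s (b hξ) = s * ξ := (skewPrim_values hξ s).2.2.1
@[simp] theorem skewPrim_c (s : 𝕜) : skewPrim hξ s (c hξ) = s * ξ := (skewPrim_values hξ s).2.2.2.1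
@[simp] theorem skewPrim_d (s : 𝕜) : skewPrim hξ s (d hξ) = 0 := (skewPrim_values hξ s).2.2.2.2.1
theorem skewPrim_a_sq (s : 𝕜) : skewPrim hξ s (a hξ ^ 2) = 0 :=
  (skewPrim_values hξ s).2.2.2.2.2.1
theorem skewPrim_a_mul_b (s : 𝕜) : skewPrim hξ s (a hξ * b hξ) = s * ξ :=
  (skewPrim_values hξ s).2.2.2.2.2.2.1
theorem skewPrim_a_mul_c (s : 𝕜) : skewPrim hξ s (a hξ * c hξ) = s * ξ :=
  (skewPrim_values hξ s).2.2.2.2.2.2.2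

/-- The functional is the off-diagonal entry of an upper triangular representation with diagonal `ε,
α₁`; this is the corresponding entry of a matrix product. Dually, `x` is skew-primitive, which
governs how it commutes with `K`. -/
theorem skewPrim_mul (s : 𝕜) (u v : KAlg hξ) : skewPrim hξ s (u * v) =
    Coalgebra.counit (R := 𝕜) u * skewPrim hξ s v + skewPrim hξ s u * alpha hξ v := by
  have h0 : ∀ u, skewRep hξ (s * ξ) u 0 0 = Coalgebra.counit (R := 𝕜) u := fun u => by
    refine LinearMap.congr_fun (linearMap_ext (f := Matrix.entryLinearMap 𝕜 𝕜 0 0 ∘ₗ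
      (skewRep hξ (s * ξ)).toLinearMap) (g := Coalgebra.counit (R := 𝕜)) ?_ ?_ ?_ ?_ ?_ ?_ ?_ ?_) u
    all_goals simp [skewRep, counit_a, counit_b, counit_c, counit_d, sq]
  have h1 : ∀ u, skewRep hξ (s * ξ) u 1 1 = alpha hξ u := fun u => by
    refine LinearMap.congr_fun (linearMap_ext (f := Matrix.entryLinearMap 𝕜 𝕜 1 1 ∘ₗ
      (skewRep hξ (s * ξ)).toLinearMap) (g := (alpha hξ).toLinearMap) ?_ ?_ ?_ ?_ ?_ ?_ ?_ ?_) u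
    all_goals simp [skewRep, alpha, sq]
  simp [skewPrim, Matrix.mul_apply, h0, h1]

theorem gDual_mul_xDual (s : 𝕜) : gDual hξ * xDual hξ s = -(xDual hξ s * gDual hξ) := by
  have hx := xi_mul_xi hξ
  apply dual_ext <;> simp only [ev_mul_one, ev_mul_a, ev_mul_b, ev_mul_c, ev_mul_d, ev_mul_a_sq,
    ev_mul_a_mul_b, ev_mul_a_mul_c, ev_gDual, ev_xDual, alpha_a, alpha_b, alpha_c, alpha_d,
    map_one, map_mul, map_pow, skewPrim_one, skewPrim_a, skewPrim_b, skewPrim_c, skewPrim_d,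
    skewPrim_a_sq, skewPrim_a_mul_b, skewPrim_a_mul_c,
    ev_neg, LinearMap.neg_apply] <;> grind

theorem gDual_pow_four : gDual hξ * gDual hξ * (gDual hξ * gDual hξ) = 1 := by
  have hx := xi_mul_xi hξ
  apply dual_ext <;> simp only [ev_mul_one, ev_mul_a, ev_mul_b, ev_mul_c, ev_mul_d, ev_mul_a_sq,
    ev_mul_a_mul_b, ev_mul_a_mul_c, ev_gDual, alpha_a, alpha_b, alpha_c, alpha_d,
    map_one, map_mul, map_pow,
    ev_one, Bialgebra.counit_one, Bialgebra.counit_mul, Bialgebra.counit_pow,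
    counit_a, counit_b, counit_c, counit_d] <;> grind

/-- The normalisation `s² = 2` is what fits: at `a` and `d` the left side is `(s ξ)² = -2`, and the
right side is `ξ² - 1`. -/
theorem xDual_mul_xDual {s : 𝕜} (hs : s ^ 2 = 2) :
    xDual hξ s * xDual hξ s = gDual hξ * gDual hξ - 1 := by
  have hx := xi_mul_xi hξ
  apply dual_ext <;> simp only [ev_mul_one, ev_mul_a, ev_mul_b, ev_mul_c, ev_mul_d, ev_mul_a_sq,
    ev_mul_a_mul_b, ev_mul_a_mul_c, ev_gDual, ev_xDual, alpha_a, alpha_b, alpha_c, alpha_d,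
    map_one, map_mul, map_pow, skewPrim_one, skewPrim_a, skewPrim_b, skewPrim_c, skewPrim_d,
    skewPrim_a_sq, skewPrim_a_mul_b, skewPrim_a_mul_c,
    ev_one, Bialgebra.counit_one, Bialgebra.counit_mul, Bialgebra.counit_pow,
    counit_a, counit_b, counit_c, counit_d, ev_sub,
    LinearMap.sub_apply] <;> grind

/-- The functionals `g^k` vanish on `b, c, ab, ac` and the `x g^k` vanish on `1, a, a², d`. On the
complementary four elements their values are characters of `ℤ/4` (up to the factor `s ξ` for `x
g^k`), so the coefficients come from Fourier inversion. -/
theorem dual_eq_sum [CharZero 𝕜] {s : 𝕜} (hs : s ^ 2 = 2) (f : Dual hξ) :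
    ∃ p q : Fin 4 → 𝕜, f = p 0 • 1 + p 1 • gDual hξ + p 2 • (gDual hξ * gDual hξ) +
        p 3 • (gDual hξ * gDual hξ * gDual hξ) +
      (q 0 • xDual hξ s + q 1 • (xDual hξ s * gDual hξ) +
        q 2 • (xDual hξ s * gDual hξ * gDual hξ) +
        q 3 • (xDual hξ s * gDual hξ * gDual hξ * gDual hξ)) := by
  have hx := xi_mul_xi hξ
  obtain ⟨e, he⟩ : ∃ e : 𝕜, 4 * e = 1 := ⟨4⁻¹, mul_inv_cancel₀ (by norm_num)⟩
  -- Since `(s ξ)² = -2`, the product is `4 e² = e`; thus `r = 1 / (4 s ξ)`.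
  obtain ⟨r, hr⟩ : ∃ r : 𝕜, s * ξ * r = e := ⟨-(s * ξ) * (2 * e * e), by grind⟩
  -- Inverse transforms: `g^k` takes the values `1, (-ξ)^k, (-1)^k, ξ^k` on `1, a, a², d`, and `x
  -- g^k` takes `s ξ` times `ξ^k, 1, (-ξ)^k, (-1)^k` on `c, ac, b, ab`.
  refine ⟨![e * (ev f 1 + ev f (a hξ) + ev f (a hξ ^ 2) + ev f (d hξ)),
    e * (ev f 1 + ξ * ev f (a hξ) - ev f (a hξ ^ 2) - ξ * ev f (d hξ)),
    e * (ev f 1 - ev f (a hξ) + ev f (a hξ ^ 2) - ev f (d hξ)),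
    e * (ev f 1 - ξ * ev f (a hξ) - ev f (a hξ ^ 2) + ξ * ev f (d hξ))],
    ![r * (ev f (c hξ) + ev f (a hξ * c hξ) + ev f (b hξ) + ev f (a hξ * b hξ)),
    r * (-ξ * ev f (c hξ) + ev f (a hξ * c hξ) + ξ * ev f (b hξ) - ev f (a hξ * b hξ)),
    r * (-ev f (c hξ) + ev f (a hξ * c hξ) - ev f (b hξ) + ev f (a hξ * b hξ)),
    r * (ξ * ev f (c hξ) + ev f (a hξ * c hξ) - ξ * ev f (b hξ) - ev f (a hξ * b hξ))], ?_⟩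
  apply dual_ext <;> simp only [ev_mul_one, ev_mul_a, ev_mul_b, ev_mul_c, ev_mul_d, ev_mul_a_sq,
    ev_mul_a_mul_b, ev_mul_a_mul_c, ev_gDual, ev_xDual, alpha_a, alpha_b, alpha_c, alpha_d,
    map_one, map_mul, map_pow, skewPrim_one, skewPrim_a, skewPrim_b, skewPrim_c, skewPrim_d,
    skewPrim_a_sq, skewPrim_a_mul_b, skewPrim_a_mul_c,
    ev_one, Bialgebra.counit_one, Bialgebra.counit_mul, Bialgebra.counit_pow,
    counit_a, counit_b, counit_c, counit_d,
    ev_add, ev_smul, LinearMap.add_apply, LinearMap.smul_apply, smul_eq_mul, Matrix.cons_val] <;> grind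

theorem adjoin_gDual_xDual [CharZero 𝕜] {s : 𝕜} (hs : s ^ 2 = 2) :
    Algebra.adjoin 𝕜 {gDual hξ, xDual hξ s} = ⊤ := by
  rw [eq_top_iff]
  rintro f -
  have hg : gDual hξ ∈ Algebra.adjoin 𝕜 {gDual hξ, xDual hξ s} := Algebra.subset_adjoin (by simp)
  have hx : xDual hξ s ∈ Algebra.adjoin 𝕜 {gDual hξ, xDual hξ s} :=
    Algebra.subset_adjoin (by simp)
  obtain ⟨p, q, rfl⟩ := dual_eq_sum hs f
  have hs (r : 𝕜) {y} (hy : y ∈ Algebra.adjoin 𝕜 {gDual hξ, xDual hξ s}) :=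
    Subalgebra.smul_mem _ hy r
  have hg2 := mul_mem hg hg
  exact add_mem (add_mem (add_mem (add_mem (hs _ (one_mem _)) (hs _ hg)) (hs _ hg2))
    (hs _ (mul_mem hg2 hg))) (add_mem (add_mem (add_mem (hs _ hx) (hs _ (mul_mem hx hg)))
      (hs _ (mul_mem (mul_mem hx hg) hg))) (hs _ (mul_mem (mul_mem (mul_mem hx hg) hg) hg)))

/-- Evaluating a linear relation at the eight functionals `g^k` and `x g^k` gives two invertible
Fourier systems for its coefficients. -/
theorem linearIndependent_basisVec [CharZero 𝕜] :
    LinearIndependent 𝕜 (basisVec hξ) := by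
  have hx := xi_mul_xi hξ
  have h2 : (2 : 𝕜) ≠ 0 := by norm_num
  rw [Fintype.linearIndependent_iff]
  intro w hw
  have key (f : Dual hξ) := congr(ev f $hw)
  simp only [basisVec, Fin.sum_univ_eight, Matrix.cons_val, map_add, map_smul, map_zero,
    smul_eq_mul] at key
  let G := gDual hξ
  -- Only the nonvanishing of the scale matters here, so it is taken to be `1`.
  let X := xDual hξ 1
  have e0 := key 1
  have e1 := key G
  have e2 := key (G * G)
  have e3 := key (G * G * G)
  have f0 := key X
  have f1 := key (X * G)
  have f2 := key (X * G * G)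
  have f3 := key (X * G * G * G)
  simp only [G, X, ev_mul_one, ev_mul_a, ev_mul_b, ev_mul_c, ev_mul_d, ev_mul_a_sq,
    ev_mul_a_mul_b, ev_mul_a_mul_c, ev_gDual, ev_xDual, alpha_a, alpha_b, alpha_c, alpha_d,
    map_one, map_mul, map_pow, skewPrim_one, skewPrim_a, skewPrim_b, skewPrim_c, skewPrim_d,
    skewPrim_a_sq, skewPrim_a_mul_b, skewPrim_a_mul_c,
    ev_one, Bialgebra.counit_one, Bialgebra.counit_mul, Bialgebra.counit_pow,
    counit_a, counit_b, counit_c, counit_d] at e0 e1 e2 e3 f0 f1 f2 f3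
  clear key hw
  intro i
  fin_cases i <;> simp only [Fin.zero_eta, Fin.mk_one, Fin.reduceFinMk] <;> grind

theorem finrank_eq [CharZero 𝕜] : Module.finrank 𝕜 (KAlg hξ) = 8 := by
  have := Module.finrank_eq_card_basis
    (Module.Basis.mk (linearIndependent_basisVec (hξ := hξ)) span_basisVec.ge)
  simpa using this

end KAlg

theorem DK.finrank_eq {𝕜 : Type*} [Field 𝕜] [CharZero 𝕜] {ξ : 𝕜} (hξ : IsPrimitiveRoot ξ 4) :
    Module.finrank 𝕜 (DK hξ) = 64 := by
  have h : Module.finrank 𝕜 (Cop 𝕜 (KAlg hξ)) = 8 := KAlg.finrank_eq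
  have h' : Module.finrank 𝕜 (KAlg.Dual hξ) = 8 := by
    rw [← (KAlg.toDual hξ).finrank_eq]
    exact (Subspace.dual_finrank_eq (K := 𝕜) (V := KAlg hξ)).trans KAlg.finrank_eq
  change Module.finrank 𝕜 (KAlg.Dual hξ ⊗[𝕜] Cop 𝕜 (KAlg hξ)) = 64
  rw [Module.finrank_tensorProduct, h, h']

/-! ### Algebra maps out of a Drinfeld double -/

namespace DrinfeldDouble

variable (𝕜 : Type*) (H : Type*) [Field 𝕜] [Ring H] [HopfAlgebra 𝕜 H] [HasBijectiveAntipode 𝕜 H]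

theorem bowtie_one_mul (f g : DualAlg 𝕜 H) (k : H) :
    bowtie 𝕜 H f 1 * bowtie 𝕜 H g k = bowtie 𝕜 H (f * g) k := by
  rw [bowtie_mul_bowtie, comul3_one, straighten_one]
  rfl

theorem one_bowtie_mul (h : H) (g : DualAlg 𝕜 H) (k : H) :
    bowtie 𝕜 H 1 h * bowtie 𝕜 H g k = straighten 𝕜 H (comul3 𝕜 H h) (g ⊗ₜ k) := by
  rw [bowtie_mul_bowtie]
  generalize straighten 𝕜 H (comul3 𝕜 H h) (g ⊗ₜ k) = z
  change leftDual 𝕜 H 1 z = z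
  induction z with
  | zero => simp
  | add x y hx hy => rw [map_add, hx, hy]
  | tmul x y => simp

theorem one_bowtie_mul_one_bowtie (h k : H) :
    bowtie 𝕜 H 1 h * bowtie 𝕜 H 1 k = bowtie 𝕜 H 1 (h * k) := by
  rw [one_bowtie_mul, straighten_mulRight]
  change (LinearMap.mulRight 𝕜 k).lTensor _ (leftH 𝕜 H h (1 ⊗ₜ 1)) = _
  rw [leftH_apply_one]
  rfl

/-- The inclusion `h ↦ ε ⋈ h`. -/
def inclH : H →ₐ[𝕜] DrinfeldDouble 𝕜 H :=
  AlgHom.ofLinearMap (TensorProduct.mk 𝕜 (DualAlg 𝕜 H) H 1 : H →ₗ[𝕜] DrinfeldDouble 𝕜 H) rfl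
    fun h k => (one_bowtie_mul_one_bowtie 𝕜 H h k).symm

/-- The inclusion `f ↦ f ⋈ 1`. -/
def inclDual : DualAlg 𝕜 H →ₐ[𝕜] DrinfeldDouble 𝕜 H :=
  AlgHom.ofLinearMap
    ((TensorProduct.mk 𝕜 (DualAlg 𝕜 H) H).flip 1 : DualAlg 𝕜 H →ₗ[𝕜] DrinfeldDouble 𝕜 H) rfl
    fun f g => (bowtie_one_mul 𝕜 H f g 1).symm

variable {𝕜 H}

theorem inclDual_mul_inclH (f : DualAlg 𝕜 H) (h : H) :
    inclDual 𝕜 H f * inclH 𝕜 H h = bowtie 𝕜 H f h := by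
  refine (bowtie_one_mul 𝕜 H f 1 h).trans ?_
  rw [mul_one]

theorem inclH_mul_inclDual (h : H) (f : DualAlg 𝕜 H) :
    inclH 𝕜 H h * inclDual 𝕜 H f = straighten 𝕜 H (comul3 𝕜 H h) (f ⊗ₜ 1) :=
  one_bowtie_mul 𝕜 H h f 1

theorem induction {P : DrinfeldDouble 𝕜 H → Prop} (zero : P 0)
    (add : ∀ x y, P x → P y → P (x + y))
    (mul : ∀ f h, P (inclDual 𝕜 H f * inclH 𝕜 H h)) (z : DrinfeldDouble 𝕜 H) : P z := by
  refine TensorProduct.induction_on (motive := P) z zero (fun f h => ?_) add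
  have := mul f h
  rwa [inclDual_mul_inclH] at this

variable {A : Type*} [Ring A] [Algebra 𝕜 A] (ψ : DualAlg 𝕜 H →ₐ[𝕜] A) (φ : H →ₐ[𝕜] A)

/-- The linear map `f ⋈ h ↦ ψ f * φ h`. -/
def liftLinear : DrinfeldDouble 𝕜 H →ₗ[𝕜] A :=
  (LinearMap.mul' 𝕜 A ∘ₗ TensorProduct.map ψ.toLinearMap φ.toLinearMap :
    DualAlg 𝕜 H ⊗[𝕜] H →ₗ[𝕜] A)

theorem liftLinear_inclDual_mul_inclH (f : DualAlg 𝕜 H) (h : H) :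
    liftLinear ψ φ (inclDual 𝕜 H f * inclH 𝕜 H h) = ψ f * φ h := by
  rw [inclDual_mul_inclH]
  rfl

theorem liftLinear_inclDual (f : DualAlg 𝕜 H) : liftLinear ψ φ (inclDual 𝕜 H f) = ψ f := by
  simpa using liftLinear_inclDual_mul_inclH ψ φ f 1

theorem liftLinear_inclH (h : H) : liftLinear ψ φ (inclH 𝕜 H h) = φ h := by
  simpa using liftLinear_inclDual_mul_inclH ψ φ 1 h

theorem liftLinear_inclDual_mul (f : DualAlg 𝕜 H) (z : DrinfeldDouble 𝕜 H) :
    liftLinear ψ φ (inclDual 𝕜 H f * z) = ψ f * liftLinear ψ φ z := by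
  induction z using induction with
  | zero => simp
  | add x y hx hy => simp only [mul_add, map_add, hx, hy]
  | mul g h =>
    rw [← mul_assoc, ← map_mul, liftLinear_inclDual_mul_inclH, liftLinear_inclDual_mul_inclH,
      map_mul, mul_assoc]

theorem liftLinear_mul_inclH (z : DrinfeldDouble 𝕜 H) (h : H) :
    liftLinear ψ φ (z * inclH 𝕜 H h) = liftLinear ψ φ z * φ h := by
  induction z using induction with
  | zero => simp
  | add x y hx hy => simp only [add_mul, map_add, hx, hy]
  | mul g k =>
    rw [mul_assoc, ← map_mul, liftLinear_inclDual_mul_inclH, liftLinear_inclDual_mul_inclH,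
      map_mul, mul_assoc]

/-- The algebra map `f ⋈ h ↦ ψ f * φ h`, for `h` in a generating set compatible with all `f`. -/
def lift (S : Set H) (hS : Algebra.adjoin 𝕜 S = ⊤)
    (hc : ∀ h ∈ S, ∀ f, liftLinear ψ φ (inclH 𝕜 H h * inclDual 𝕜 H f) = φ h * ψ f) :
    DrinfeldDouble 𝕜 H →ₐ[𝕜] A :=
  AlgHom.ofLinearMap (liftLinear ψ φ) ((liftLinear_inclDual ψ φ 1).trans (map_one ψ)) <| by
    -- The elements `h` satisfying this for every `z` form a subalgebra, so the generating set
    -- suffices. The quantifier over `z` must stay inside the induction for products.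
    have key : ∀ h z, liftLinear ψ φ (inclH 𝕜 H h * z) = φ h * liftLinear ψ φ z := by
      intro h
      have hh : h ∈ Algebra.adjoin 𝕜 S := hS ▸ Algebra.mem_top
      induction hh using Algebra.adjoin_induction with
      | mem h hh =>
        intro z
        induction z using induction with
        | zero => simp
        | add x y hx hy => simp only [mul_add, map_add, hx, hy]
        | mul f k =>
          rw [← mul_assoc, liftLinear_mul_inclH, hc h hh, liftLinear_inclDual_mul_inclH, mul_assoc]
      | algebraMap r => intro z; simp [← Algebra.smul_def]
      | add x y _ _ hx hy => intro z; simp only [map_add, add_mul, hx, hy]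
      | mul x y _ _ hx hy => intro z; simp only [map_mul, mul_assoc, hx, hy]
    intro x y
    induction x using induction with
    | zero => simp
    | add x x' hx hx' => simp only [add_mul, map_add, hx, hx']
    | mul f h =>
      rw [mul_assoc, liftLinear_inclDual_mul, key, liftLinear_inclDual_mul_inclH, mul_assoc]

theorem lift_inclH {S : Set H} (hS : Algebra.adjoin 𝕜 S = ⊤)
    (hc : ∀ h ∈ S, ∀ f, liftLinear ψ φ (inclH 𝕜 H h * inclDual 𝕜 H f) = φ h * ψ f) (h : H) :
    lift ψ φ S hS hc (inclH 𝕜 H h) = φ h := liftLinear_inclH ψ φ h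

theorem lift_inclDual {S : Set H} (hS : Algebra.adjoin 𝕜 S = ⊤)
    (hc : ∀ h ∈ S, ∀ f, liftLinear ψ φ (inclH 𝕜 H h * inclDual 𝕜 H f) = φ h * ψ f)
    (f : DualAlg 𝕜 H) : lift ψ φ S hS hc (inclDual 𝕜 H f) = ψ f := liftLinear_inclDual ψ φ f

end DrinfeldDouble

/-! ### Exchange relations between `K` and its dual inside `D` -/

namespace DK

open KAlg (Dual gDual xDual ev ev_apply)

variable {𝕜 : Type*} [Field 𝕜] {ξ : 𝕜} {hξ : IsPrimitiveRoot ξ 4}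

variable (hξ) in
/-- The inclusion of `K` into `D`. -/
def inclK : KAlg hξ →ₐ[𝕜] DK hξ :=
  (DrinfeldDouble.inclH 𝕜 (Cop 𝕜 (KAlg hξ))).comp (toCop 𝕜 (KAlg hξ)).toAlgHom

variable (hξ) in
/-- The inclusion of the dual algebra into `D`. -/
abbrev inclDual : Dual hξ →ₐ[𝕜] DK hξ := DrinfeldDouble.inclDual 𝕜 (Cop 𝕜 (KAlg hξ))

theorem inclK_a : inclK hξ (KAlg.a hξ) = a hξ := rfl
theorem inclK_b : inclK hξ (KAlg.b hξ) = b hξ := rfl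
theorem inclK_c : inclK hξ (KAlg.c hξ) = c hξ := rfl
theorem inclK_d : inclK hξ (KAlg.d hξ) = d hξ := rfl
theorem inclDual_gDual : inclDual hξ (gDual hξ) = g hξ := rfl
theorem inclDual_xDual (s : 𝕜) : inclDual hξ (xDual hξ s) = x hξ s := rfl

/-- The functional `u ↦ f (S(q) u p)`. -/
def coact (p q : KAlg hξ) (f : Dual hξ) : Dual hξ :=
  coadjFun 𝕜 (Cop 𝕜 (KAlg hξ)) (toCop 𝕜 _ p) (toCop 𝕜 _ q) f

/-- The inverse antipode of `K^cop` is the antipode of `K`. -/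
theorem ev_coact (p q : KAlg hξ) (f : Dual hξ) (u : KAlg hξ) :
    ev (coact p q f) u = ev f (HopfAlgebra.antipode 𝕜 q * u * p) := by
  rw [ev_apply, coact, coadjFun_apply, invAntipode_toCop]
  rfl

open Coalgebra in
theorem comul_toCop (u : KAlg hξ) : comul (R := 𝕜) (toCop 𝕜 _ u) =
    TensorProduct.map (toCop 𝕜 (KAlg hξ)).toLinearMap (toCop 𝕜 (KAlg hξ)).toLinearMap
      (TensorProduct.comm 𝕜 _ _ (comul (R := 𝕜) u)) := by
  have : comul (R := 𝕜) (toCop 𝕜 _ u) = (TensorProduct.comm 𝕜 _ _ (comul (R := 𝕜) u) :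
    KAlg hξ ⊗[𝕜] KAlg hξ) := rfl
  rw [this]
  exact (LinearMap.congr_fun TensorProduct.map_id _).symm

theorem straighten_toCop (p m q : KAlg hξ) (f : Dual hξ) :
    straighten 𝕜 (Cop 𝕜 (KAlg hξ)) (toCop 𝕜 _ p ⊗ₜ (toCop 𝕜 _ m ⊗ₜ toCop 𝕜 _ q)) (f ⊗ₜ 1) =
      inclDual hξ (coact p q f) * inclK hξ m := by
  rw [straighten_tmul, mul_one]
  exact (DrinfeldDouble.inclDual_mul_inclH _ _).symm

/-- The elements `a, b, c, d` are the entries of a multiplicative matrix `T`. With the legs reversed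
in `K^cop`, the product rule reads `T_ij f = ∑ f(S(T_ik) ? T_lj) T_kl`. The next three lemmas are
the other entries. -/
theorem a_mul_inclDual (f : Dual hξ) : a hξ * inclDual hξ f =
    inclDual hξ (coact (KAlg.a hξ) (KAlg.a hξ) f) * a hξ +
    inclDual hξ (coact (KAlg.a hξ) (KAlg.b hξ) f) * c hξ +
    inclDual hξ (coact (KAlg.c hξ) (KAlg.a hξ) f) * b hξ +
    inclDual hξ (coact (KAlg.c hξ) (KAlg.b hξ) f) * d hξ := by
  refine (DrinfeldDouble.inclH_mul_inclDual (toCop 𝕜 _ (KAlg.a hξ)) f).trans ?_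
  simp only [← inclK_a, ← inclK_b, ← inclK_c, ← inclK_d, ← straighten_toCop]
  simp [comul3, comul_toCop, KAlg.comul_a, KAlg.comul_b, TensorProduct.tmul_add, -straighten_tmul]
  abel

theorem b_mul_inclDual (f : Dual hξ) : b hξ * inclDual hξ f =
    inclDual hξ (coact (KAlg.b hξ) (KAlg.a hξ) f) * a hξ +
    inclDual hξ (coact (KAlg.b hξ) (KAlg.b hξ) f) * c hξ +
    inclDual hξ (coact (KAlg.d hξ) (KAlg.a hξ) f) * b hξ +
    inclDual hξ (coact (KAlg.d hξ) (KAlg.b hξ) f) * d hξ := by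
  refine (DrinfeldDouble.inclH_mul_inclDual (toCop 𝕜 _ (KAlg.b hξ)) f).trans ?_
  simp only [← inclK_a, ← inclK_b, ← inclK_c, ← inclK_d, ← straighten_toCop]
  simp [comul3, comul_toCop, KAlg.comul_a, KAlg.comul_b, TensorProduct.tmul_add, -straighten_tmul]
  abel

theorem c_mul_inclDual (f : Dual hξ) : c hξ * inclDual hξ f =
    inclDual hξ (coact (KAlg.a hξ) (KAlg.c hξ) f) * a hξ +
    inclDual hξ (coact (KAlg.a hξ) (KAlg.d hξ) f) * c hξ +
    inclDual hξ (coact (KAlg.c hξ) (KAlg.c hξ) f) * b hξ +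
    inclDual hξ (coact (KAlg.c hξ) (KAlg.d hξ) f) * d hξ := by
  refine (DrinfeldDouble.inclH_mul_inclDual (toCop 𝕜 _ (KAlg.c hξ)) f).trans ?_
  simp only [← inclK_a, ← inclK_b, ← inclK_c, ← inclK_d, ← straighten_toCop]
  simp [comul3, comul_toCop, KAlg.comul_c, KAlg.comul_d, TensorProduct.tmul_add, -straighten_tmul]
  abel

theorem d_mul_inclDual (f : Dual hξ) : d hξ * inclDual hξ f =
    inclDual hξ (coact (KAlg.b hξ) (KAlg.c hξ) f) * a hξ +
    inclDual hξ (coact (KAlg.b hξ) (KAlg.d hξ) f) * c hξ +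
    inclDual hξ (coact (KAlg.d hξ) (KAlg.c hξ) f) * b hξ +
    inclDual hξ (coact (KAlg.d hξ) (KAlg.d hξ) f) * d hξ := by
  refine (DrinfeldDouble.inclH_mul_inclDual (toCop 𝕜 _ (KAlg.d hξ)) f).trans ?_
  simp only [← inclK_a, ← inclK_b, ← inclK_c, ← inclK_d, ← straighten_toCop]
  simp [comul3, comul_toCop, KAlg.comul_c, KAlg.comul_d, TensorProduct.tmul_add, -straighten_tmul]
  abel

open KAlg in
theorem coact_gDual (p q : KAlg hξ) :
    coact p q (gDual hξ) = (alpha hξ (HopfAlgebra.antipode 𝕜 q) * alpha hξ p) • gDual hξ := by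
  apply KAlg.ev_injective
  ext u
  rw [ev_coact]
  simp only [ev_gDual, map_mul, ev_smul, LinearMap.smul_apply, smul_eq_mul]
  ring

open KAlg in
-- Two applications of `skewPrim_mul` to `S(q) u p`: the orbit of `x` stays in the span of `1, x,
-- g`, which keeps the exchange relations for `x` short.
theorem coact_xDual (s : 𝕜) (p q : KAlg hξ) :
    coact p q (xDual hξ s) =
      (Coalgebra.counit (R := 𝕜) q * skewPrim hξ s p) • 1 +
      (Coalgebra.counit (R := 𝕜) q * alpha hξ p) • xDual hξ s +
      (skewPrim hξ s (HopfAlgebra.antipode 𝕜 q) * alpha hξ p) • gDual hξ := by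
  apply KAlg.ev_injective
  ext u
  rw [ev_coact]
  simp only [ev_gDual, ev_xDual, ev_add, ev_one, ev_smul, LinearMap.smul_apply,
    smul_eq_mul, LinearMap.add_apply, skewPrim_mul, Bialgebra.counit_mul,
    HopfAlgebra.counit_antipode]
  ring

end DK

namespace KAlg
variable {𝕜 : Type*} [Field 𝕜] {ξ : 𝕜} {hξ : IsPrimitiveRoot ξ 4}

@[simp] theorem antipode_a : HopfAlgebra.antipode 𝕜 (a hξ) = d hξ := by
  simp [antipode_eq, antipodeOp]
@[simp] theorem antipode_b : HopfAlgebra.antipode 𝕜 (b hξ) = ξ • b hξ := by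
  simp [antipode_eq, antipodeOp]
@[simp] theorem antipode_c : HopfAlgebra.antipode 𝕜 (c hξ) = -ξ • c hξ := by
  simp [antipode_eq, antipodeOp]
@[simp] theorem antipode_d : HopfAlgebra.antipode 𝕜 (d hξ) = a hξ := by
  simp [antipode_eq, antipodeOp]

end KAlg

namespace DK

open KAlg (Dual gDual xDual ev ev_apply)

variable {𝕜 : Type*} [Field 𝕜] {ξ : 𝕜} {hξ : IsPrimitiveRoot ξ 4}

theorem a_mul_g : a hξ * g hξ = g hξ * a hξ := by
  rw [← inclDual_gDual, a_mul_inclDual]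
  simp [coact_gDual, KAlg.xi_mul_xi hξ]

theorem b_mul_g : b hξ * g hξ = -(g hξ * b hξ) := by
  rw [← inclDual_gDual, b_mul_inclDual]
  simp [coact_gDual, KAlg.xi_mul_xi hξ]

theorem c_mul_g : c hξ * g hξ = -(g hξ * c hξ) := by
  rw [← inclDual_gDual, c_mul_inclDual]
  simp [coact_gDual, KAlg.xi_mul_xi hξ]

theorem d_mul_g : d hξ * g hξ = g hξ * d hξ := by
  rw [← inclDual_gDual, d_mul_inclDual]
  simp [coact_gDual, KAlg.xi_mul_xi hξ]

theorem a_mul_x (s : 𝕜) : a hξ * x hξ s =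
    -ξ • (x hξ s * a hξ) + (s * ξ) • b hξ + (s * ξ) • (g hξ * c hξ) := by
  have hx : ξ * (s * ξ) = -s := by linear_combination s * KAlg.xi_mul_xi hξ
  rw [← inclDual_xDual, a_mul_inclDual]
  simp [coact_xDual, inclDual_gDual, inclDual_xDual, hx]
  abel

theorem b_mul_x (s : 𝕜) : b hξ * x hξ s =
    ξ • (x hξ s * b hξ) + (s * ξ) • a hξ - (s * ξ) • (g hξ * d hξ) := by
  have hx : ξ * (s * ξ) = -s := by linear_combination s * KAlg.xi_mul_xi hξ
  rw [← inclDual_xDual, b_mul_inclDual]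
  simp [coact_xDual, inclDual_gDual, inclDual_xDual, hx]
  abel

theorem c_mul_x (s : 𝕜) : c hξ * x hξ s =
    -ξ • (x hξ s * c hξ) + (s * ξ) • d hξ - (s * ξ) • (g hξ * a hξ) := by
  have hx : ξ * (s * ξ) = -s := by linear_combination s * KAlg.xi_mul_xi hξ
  rw [← inclDual_xDual, c_mul_inclDual]
  simp [coact_xDual, inclDual_gDual, inclDual_xDual, hx]
  abel

theorem d_mul_x (s : 𝕜) : d hξ * x hξ s =
    ξ • (x hξ s * d hξ) + (s * ξ) • c hξ + (s * ξ) • (g hξ * b hξ) := by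
  have hx : ξ * (s * ξ) = -s := by linear_combination s * KAlg.xi_mul_xi hξ
  rw [← inclDual_xDual, d_mul_inclDual]
  simp [coact_xDual, inclDual_gDual, inclDual_xDual, hx]
  abel

end DK

/-! ### Representations of the dual algebra by evaluation -/

namespace KAlg
variable {𝕜 : Type*} [Field 𝕜] {ξ : 𝕜} {hξ : IsPrimitiveRoot ξ 4}

/-- A grouplike element of `K` gives a character of the dual algebra. -/
def evalGrouplike (u : KAlg hξ) (h1 : Coalgebra.counit (R := 𝕜) u = 1)
    (h : Coalgebra.comul (R := 𝕜) u = u ⊗ₜ u) : Dual hξ →ₐ[𝕜] 𝕜 :=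
  AlgHom.ofLinearMap
    { toFun := fun f => ev f u, map_add' := fun _ _ => rfl, map_smul' := fun _ _ => rfl }
    h1 fun f g => by
      change ev (f * g) u = ev f u * ev g u
      simp [ev_mul, h, mul_comm]

theorem evalGrouplike_apply (u : KAlg hξ) (h1 : Coalgebra.counit (R := 𝕜) u = 1)
    (h : Coalgebra.comul (R := 𝕜) u = u ⊗ₜ u) (f : Dual hξ) : evalGrouplike u h1 h f = ev f u :=
  rfl

/-- A matrix `M` over `K` with `Δ(Mᵢⱼ) = ∑ Mₖⱼ ⊗ Mᵢₖ` and `ε(M) = 1` gives a representation of the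
dual algebra. -/
def evalMatrix {n : ℕ} (M : Matrix (Fin n) (Fin n) (KAlg hξ))
    (h1 : M.map (Coalgebra.counit (R := 𝕜)) = 1)
    (h : ∀ i j, Coalgebra.comul (R := 𝕜) (M i j) = ∑ k, M k j ⊗ₜ M i k) :
    Dual hξ →ₐ[𝕜] Matrix (Fin n) (Fin n) 𝕜 :=
  AlgHom.ofLinearMap
    { toFun := fun f => M.map (ev f), map_add' := fun _ _ => rfl, map_smul' := fun _ _ => rfl }
    h1 fun f g => by
      ext i j
      change ev (f * g) (M i j) = ∑ k, ev f (M i k) * ev g (M k j)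
      simp [ev_mul, h, mul_comm]

theorem evalMatrix_apply {n : ℕ} (M : Matrix (Fin n) (Fin n) (KAlg hξ))
    (h1 : M.map (Coalgebra.counit (R := 𝕜)) = 1)
    (h : ∀ i j, Coalgebra.comul (R := 𝕜) (M i j) = ∑ k, M k j ⊗ₜ M i k) (f : Dual hξ) :
    evalMatrix M h1 h f = M.map (ev f) := rfl

end KAlg

/-! ### Powers of `ξ` with exponents modulo 4 -/

section xiPow
variable {𝕜 : Type*} [Field 𝕜] {ξ : 𝕜}

theorem xiPow_natCast (hξ : IsPrimitiveRoot ξ 4) (n : ℕ) : xiPow ξ (n : ZMod 4) = ξ ^ n := by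
  rw [xiPow, ZMod.val_natCast, ← pow_eq_pow_mod n hξ.pow_eq_one]

theorem xiPow_add (hξ : IsPrimitiveRoot ξ 4) (m n : ZMod 4) :
    xiPow ξ (m + n) = xiPow ξ m * xiPow ξ n := by
  rw [← ZMod.natCast_zmod_val m, ← ZMod.natCast_zmod_val n, ← Nat.cast_add, xiPow_natCast hξ,
    xiPow_natCast hξ, xiPow_natCast hξ, pow_add]

theorem xiPow_zero : xiPow ξ 0 = 1 := by simp [xiPow]

theorem xiPow_one : xiPow ξ 1 = ξ := pow_one ξ

theorem xiPow_two (hξ : IsPrimitiveRoot ξ 4) : xiPow ξ 2 = -1 := by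
  rw [← KAlg.xi_mul_xi hξ, ← sq]; rfl

theorem xiPow_three (hξ : IsPrimitiveRoot ξ 4) : xiPow ξ 3 = -ξ := by
  rw [show (3 : ZMod 4) = 2 + 1 from rfl, xiPow_add hξ, xiPow_two hξ, xiPow_one, neg_one_mul]

theorem xiPow_three_mul (hξ : IsPrimitiveRoot ξ 4) (i : ZMod 4) :
    xiPow ξ (3 * i) = xiPow ξ i ^ 3 := by
  rw [show 3 * i = i + i + i by ring, xiPow_add hξ, xiPow_add hξ]
  ring

theorem xiPow_two_mul (hξ : IsPrimitiveRoot ξ 4) (i : ZMod 4) :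
    xiPow ξ (2 * i) = xiPow ξ i ^ 2 := by
  rw [two_mul, xiPow_add hξ, sq]

theorem xiPow_neg (hξ : IsPrimitiveRoot ξ 4) (i : ZMod 4) : xiPow ξ (-i) = xiPow ξ i ^ 3 := by
  rw [← xiPow_three_mul hξ, show -i = 3 * i by revert i; decide]

theorem xiPow_pow_four (hξ : IsPrimitiveRoot ξ 4) (i : ZMod 4) : xiPow ξ i ^ 4 = 1 := by
  rw [xiPow, ← pow_mul, mul_comm, pow_mul, hξ.pow_eq_one, one_pow]

theorem neg_one_pow_val (hξ : IsPrimitiveRoot ξ 4) (i : ZMod 4) :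
    (-1 : 𝕜) ^ i.val = xiPow ξ i ^ 2 := by
  rw [xiPow, ← KAlg.xi_mul_xi hξ, ← sq, ← pow_mul, ← pow_mul, mul_comm]

theorem xiPow_injective (hξ : IsPrimitiveRoot ξ 4) : Function.Injective (xiPow ξ) := by
  intro i j h
  exact ZMod.val_injective 4 (hξ.pow_inj (ZMod.val_lt i) (ZMod.val_lt j) h)

end xiPow

/-! ### Algebra maps out of `D` from relations on generators -/

namespace DK

open KAlg (Dual gDual xDual ev)

variable {𝕜 : Type*} [Field 𝕜] {ξ : 𝕜} {hξ : IsPrimitiveRoot ξ 4}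

theorem algHom_ext [CharZero 𝕜] {s : 𝕜} (hs : s ^ 2 = 2) {B : Type*} [Ring B] [Algebra 𝕜 B]
    {φ φ' : DK hξ →ₐ[𝕜] B} (ha : φ (a hξ) = φ' (a hξ)) (hb : φ (b hξ) = φ' (b hξ))
    (hc : φ (c hξ) = φ' (c hξ)) (hd : φ (d hξ) = φ' (d hξ)) (hg : φ (g hξ) = φ' (g hξ))
    (hx : φ (x hξ s) = φ' (x hξ s)) : φ = φ' := by
  have h1 : φ.comp (inclDual hξ) = φ'.comp (inclDual hξ) :=
    AlgHom.ext_of_adjoin_eq_top (KAlg.adjoin_gDual_xDual hs) (by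
      rintro _ (rfl | rfl)
      exacts [hg, hx])
  have h2 : φ.comp (inclK hξ) = φ'.comp (inclK hξ) := KAlg.algHom_ext ha hb hc hd
  ext z
  induction z using DrinfeldDouble.induction with
  | zero => simp
  | add x y hx hy => simp only [map_add, hx, hy]
  | mul f h =>
    rw [map_mul, map_mul]
    exact congr_arg₂ _ (AlgHom.congr_fun h1 f) (AlgHom.congr_fun h2 h)

/-- The commutation relations of `D` for algebra maps out of `K` and the dual algebra. -/
structure IsCompatible {A : Type*} [Ring A] [Algebra 𝕜 A] (s : 𝕜) (φ : KAlg hξ →ₐ[𝕜] A)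
    (ψ : Dual hξ →ₐ[𝕜] A) : Prop where
  ag : φ (KAlg.a hξ) * ψ (gDual hξ) = ψ (gDual hξ) * φ (KAlg.a hξ)
  bg : φ (KAlg.b hξ) * ψ (gDual hξ) = -(ψ (gDual hξ) * φ (KAlg.b hξ))
  cg : φ (KAlg.c hξ) * ψ (gDual hξ) = -(ψ (gDual hξ) * φ (KAlg.c hξ))
  dg : φ (KAlg.d hξ) * ψ (gDual hξ) = ψ (gDual hξ) * φ (KAlg.d hξ)
  ax : φ (KAlg.a hξ) * ψ (xDual hξ s) = -ξ • (ψ (xDual hξ s) * φ (KAlg.a hξ)) +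
    (s * ξ) • φ (KAlg.b hξ) + (s * ξ) • (ψ (gDual hξ) * φ (KAlg.c hξ))
  bx : φ (KAlg.b hξ) * ψ (xDual hξ s) = ξ • (ψ (xDual hξ s) * φ (KAlg.b hξ)) +
    (s * ξ) • φ (KAlg.a hξ) - (s * ξ) • (ψ (gDual hξ) * φ (KAlg.d hξ))
  cx : φ (KAlg.c hξ) * ψ (xDual hξ s) = -ξ • (ψ (xDual hξ s) * φ (KAlg.c hξ)) +
    (s * ξ) • φ (KAlg.d hξ) - (s * ξ) • (ψ (gDual hξ) * φ (KAlg.a hξ))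
  dx : φ (KAlg.d hξ) * ψ (xDual hξ s) = ξ • (ψ (xDual hξ s) * φ (KAlg.d hξ)) +
    (s * ξ) • φ (KAlg.c hξ) + (s * ξ) • (ψ (gDual hξ) * φ (KAlg.b hξ))

/-- The linear map `f ⋈ h ↦ ψ f * φ h` always exists; only its compatibility with products `h f` is
at stake. The eight relations give this for `f = g, x`, and it spreads to all `f` because `g` and
`x` generate the dual. -/
theorem exists_lift [CharZero 𝕜] {s : 𝕜} (hs : s ^ 2 = 2) {A : Type*} [Ring A] [Algebra 𝕜 A]
    {φ : KAlg hξ →ₐ[𝕜] A} {ψ : Dual hξ →ₐ[𝕜] A} (h : IsCompatible s φ ψ) :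
    ∃ Φ : DK hξ →ₐ[𝕜] A, (∀ u, Φ (inclK hξ u) = φ u) ∧ ∀ f, Φ (inclDual hξ f) = ψ f := by
  let φ' : Cop 𝕜 (KAlg hξ) →ₐ[𝕜] A := φ.comp (toCop 𝕜 (KAlg hξ)).symm.toAlgHom
  set L := DrinfeldDouble.liftLinear ψ φ' with hL
  have hLψ (f) (z : DK hξ) : L (inclDual hξ f * z) = ψ f * L z :=
    DrinfeldDouble.liftLinear_inclDual_mul ψ φ' f z
  have hLφ (u) : L (inclK hξ u) = φ u := DrinfeldDouble.liftLinear_inclH ψ φ' (toCop 𝕜 _ u)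
  -- The four generators are treated together because moving one of them past `x` produces others:
  -- `a x` involves `b` and `c`, for instance.
  let P (z : DK hξ) : Prop := L (a hξ * z) = φ (KAlg.a hξ) * L z ∧
    L (b hξ * z) = φ (KAlg.b hξ) * L z ∧ L (c hξ * z) = φ (KAlg.c hξ) * L z ∧
    L (d hξ * z) = φ (KAlg.d hξ) * L z
  have hP1 : P 1 := by
    have h1 : L 1 = 1 := (DrinfeldDouble.liftLinear_inclDual ψ φ' 1).trans (map_one ψ)
    simp only [P, mul_one, h1]
    exact ⟨hLφ _, hLφ _, hLφ _, hLφ _⟩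
  have hLg (z : DK hξ) : L (g hξ * z) = ψ (gDual hξ) * L z := hLψ _ z
  have hLx (z : DK hξ) : L (x hξ s * z) = ψ (xDual hξ s) * L z := hLψ _ z
  have hP : ∀ f : Dual hξ, ∀ z, P z → P (inclDual hξ f * z) := by
    intro f
    have hf : f ∈ Algebra.adjoin 𝕜 {gDual hξ, xDual hξ s} := by
      rw [KAlg.adjoin_gDual_xDual hs]; exact Algebra.mem_top
    induction hf using Algebra.adjoin_induction with
    | mem f hf =>
      rintro z ⟨ha, hb, hc, hd⟩
      rcases hf with rfl | rfl
      · rw [inclDual_gDual]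
        refine ⟨?_, ?_, ?_, ?_⟩ <;>
          simp only [← mul_assoc, a_mul_g, b_mul_g, c_mul_g, d_mul_g, hLg, h.ag, h.bg, h.cg, h.dg,
            neg_mul, map_neg] <;> simp only [mul_assoc, hLg, ha, hb, hc, hd]
      · rw [inclDual_xDual]
        refine ⟨?_, ?_, ?_, ?_⟩ <;>
          simp only [← mul_assoc, a_mul_x, b_mul_x, c_mul_x, d_mul_x, hLx, h.ax, h.bx, h.cx, h.dx,
            add_mul, sub_mul, smul_mul_assoc, map_add, map_sub, map_smul] <;>
          simp only [mul_assoc, hLx, hLg, ha, hb, hc, hd]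
    | algebraMap r =>
      rintro z ⟨ha, hb, hc, hd⟩
      simp only [P, AlgHom.commutes, ← Algebra.smul_def, mul_smul_comm, map_smul, ha, hb, hc, hd,
        and_self]
    | add f f' _ _ hf hf' =>
      intro z hz
      obtain ⟨ha, hb, hc, hd⟩ := hf z hz
      obtain ⟨ha', hb', hc', hd'⟩ := hf' z hz
      simp only [P, map_add, add_mul, mul_add, ha, hb, hc, hd, ha', hb', hc', hd', and_self]
    | mul f f' _ _ hf hf' =>
      intro z hz
      rw [map_mul, mul_assoc]
      exact hf _ (hf' z hz)
  have hP' (f : Dual hξ) : P (inclDual hξ f) := by simpa using hP f 1 hP1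
  have hLf (f : Dual hξ) : L (inclDual hξ f) = ψ f := DrinfeldDouble.liftLinear_inclDual ψ φ' f
  have hc : ∀ u ∈ ({KAlg.a hξ, KAlg.b hξ, KAlg.c hξ, KAlg.d hξ} : Set (KAlg hξ)), ∀ f,
      L (DrinfeldDouble.inclH 𝕜 (Cop 𝕜 (KAlg hξ)) u * inclDual hξ f) = φ' u * ψ f := by
    rintro u hu f
    obtain ⟨ha, hb, hc, hd⟩ := hP' f
    rw [hLf] at ha hb hc hd
    rcases hu with rfl | rfl | rfl | rfl
    exacts [ha, hb, hc, hd]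
  exact ⟨DrinfeldDouble.lift ψ φ' _ KAlg.adjoin_gens hc,
    DrinfeldDouble.lift_inclH ψ φ' KAlg.adjoin_gens hc,
    DrinfeldDouble.lift_inclDual ψ φ' KAlg.adjoin_gens hc⟩

end DK

/-! ### Existence of the characters and of the two-dimensional representations -/

namespace DK

open KAlg (Dual gDual xDual ev)

variable {𝕜 : Type*} [Field 𝕜] {ξ : 𝕜} {hξ : IsPrimitiveRoot ξ 4}

theorem exists_char [CharZero 𝕜] {s : 𝕜} (hs : s ^ 2 = 2) (j : ZMod 4) :
    ∃ χ : DK hξ →ₐ[𝕜] 𝕜, HasCharValues hξ s j χ := by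
  have hx := KAlg.xi_mul_xi hξ
  have hl := xiPow_pow_four hξ j
  have hT : KAlg.IsKTuple ξ (xiPow ξ j) 0 0 (xiPow ξ (-j)) := by
    rw [xiPow_neg hξ]
    constructor <;> (try simp only [smul_eq_mul]) <;> grind
  let φ : KAlg hξ →ₐ[𝕜] 𝕜 := KAlg.lift hT
  -- The element `a²` is grouplike with `α₁(a²) = -1`, so its `j`-th power gives `g` the value
  -- `(-1)^j`.
  let ψ : Dual hξ →ₐ[𝕜] 𝕜 := KAlg.evalGrouplike ((KAlg.a hξ ^ 2) ^ j.val)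
    (by simp)
    (by rw [Bialgebra.comul_pow, KAlg.comul_a_sq, Algebra.TensorProduct.tmul_pow])
  have hg : ψ (gDual hξ) = (-1) ^ j.val := by
    have : ψ (gDual hξ) = KAlg.alpha hξ ((KAlg.a hξ ^ 2) ^ j.val) := by
      simp only [ψ, KAlg.evalGrouplike_apply, KAlg.ev_gDual]
    rw [this, map_pow, map_pow, KAlg.alpha_a, neg_sq, sq, hx]
  have hx' : ψ (xDual hξ s) = 0 := by
    have h (n : ℕ) : KAlg.skewPrim hξ s ((KAlg.a hξ ^ 2) ^ n) = 0 := by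
      induction n with
      | zero => simp
      | succ n ih => rw [pow_succ, KAlg.skewPrim_mul, ih, KAlg.skewPrim_a_sq]; simp
    have : ψ (xDual hξ s) = KAlg.skewPrim hξ s ((KAlg.a hξ ^ 2) ^ j.val) := by
      simp only [ψ, KAlg.evalGrouplike_apply, KAlg.ev_xDual]
    rw [this, h]
  have hc : IsCompatible s φ ψ := by
    constructor <;> simp only [hg, hx', φ, KAlg.lift_a, KAlg.lift_b, KAlg.lift_c, KAlg.lift_d,
      xiPow_neg hξ, neg_one_pow_val hξ, smul_eq_mul] <;> grind
  obtain ⟨Φ, h1, h2⟩ := exists_lift hs hc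
  refine ⟨Φ, ?_, ?_, ?_, ?_, ?_, ?_⟩
  · rw [← inclK_a, h1]; exact KAlg.lift_a hT
  · rw [← inclK_b, h1]; exact KAlg.lift_b hT
  · rw [← inclK_c, h1]; exact KAlg.lift_c hT
  · rw [← inclK_d, h1]; exact KAlg.lift_d hT
  · rw [← inclDual_xDual, h2, hx']
  · rw [← inclDual_gDual, h2, hg]

/-- For each `j` there is a multiplicative matrix over `K` on whose diagonal `α₁` takes the values
`ξ^j, -ξ^j`. Its off-diagonal entries are then rescaled to give `x` the prescribed matrix. -/
theorem exists_dual_rep (s : 𝕜) [CharZero 𝕜] {i j : ZMod 4} (hij : 2 * i ≠ j) :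
    ∃ ψ : Dual hξ →ₐ[𝕜] Matrix (Fin 2) (Fin 2) 𝕜,
      ψ (gDual hξ) = !![xiPow ξ j, 0; 0, -xiPow ξ j] ∧
      ψ (xDual hξ s) = !![0, s / 2 * ξ * (xiPow ξ i + xiPow ξ i ^ 3 * xiPow ξ j);
        s * ξ * (xiPow ξ i ^ 3 - xiPow ξ i * xiPow ξ j), 0] := by
  have hx := KAlg.xi_mul_xi hξ
  have hl := xiPow_pow_four hξ i
  have hl2 : xiPow ξ i ^ 2 ≠ xiPow ξ j := fun h => by
    rw [← xiPow_two_mul hξ] at h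
    exact hij (xiPow_injective hξ h)
  set l := xiPow ξ i
  have hl1 : (l ^ 2 - 1) * (l ^ 2 + 1) = 0 := by linear_combination hl
  -- With `m = ξ^j`, the prescribed off-diagonal entries of `x` are `s ξ σ` and `s ξ τ`.
  let σ (m : 𝕜) : 𝕜 := (l + l ^ 3 * m) / 2
  let τ (m : 𝕜) : 𝕜 := l ^ 3 - l * m
  have aux (M : Matrix (Fin 2) (Fin 2) (KAlg hξ)) (m : 𝕜)
      (h1 : M.map (Coalgebra.counit (R := 𝕜)) = 1)
      (h : ∀ i j, Coalgebra.comul (R := 𝕜) (M i j) = ∑ k, M k j ⊗ₜ M i k)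
      (hg : M.map (KAlg.alpha hξ) = !![m, 0; 0, -m])
      (hx : M.map (KAlg.skewPrim hξ s) = !![0, s * ξ * σ m; s * ξ * τ m, 0]) :
      ∃ ψ : Dual hξ →ₐ[𝕜] Matrix (Fin 2) (Fin 2) 𝕜, ψ (gDual hξ) = !![m, 0; 0, -m] ∧
        ψ (xDual hξ s) = !![0, s / 2 * ξ * (l + l ^ 3 * m); s * ξ * (l ^ 3 - l * m), 0] := by
    refine ⟨KAlg.evalMatrix M h1 h, ?_, ?_⟩
    · rw [← hg, KAlg.evalMatrix_apply]
      ext i j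
      simp
    · have : s / 2 * ξ * (l + l ^ 3 * m) = s * ξ * σ m := by simp only [σ]; ring
      rw [this, KAlg.evalMatrix_apply, KAlg.ev_xDual, hx]
  have hj : j = 0 ∨ j = 1 ∨ j = 2 ∨ j = 3 := by clear hij hl2; revert j; decide
  rcases hj with rfl | rfl | rfl | rfl
  · rw [xiPow_zero] at hl2 ⊢
    -- The condition `2i ≠ j` leaves only this root, and then `σ 1 = 0`, so a triangular matrix with
    -- diagonal `1, a²` suffices. The case `j = 2` is analogous, with `l² = 1` and the diagonal
    -- reversed.
    have h2 : l ^ 2 = -1 := by grind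
    refine aux !![1, 0; τ 1 • (KAlg.a hξ * KAlg.c hξ), KAlg.a hξ ^ 2] 1 ?_ ?_ ?_ ?_
    · ext i j; fin_cases i <;> fin_cases j <;> simp
    · intro i j
      fin_cases i <;> fin_cases j <;>
        simp [KAlg.comul_a_mul_c, KAlg.comul_a_sq, Algebra.TensorProduct.one_def,
          TensorProduct.smul_tmul', add_comm, -Bialgebra.comul_mul, -Bialgebra.comul_pow]
    · ext i j; fin_cases i <;> fin_cases j <;> simp [hx, sq]
    · ext i j; fin_cases i <;> fin_cases j <;>
        simp [KAlg.skewPrim_a_mul_c, KAlg.skewPrim_a_sq, σ, τ] <;> grind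
  · rw [xiPow_one] at hl2 ⊢
    -- Reciprocal factors amount to a diagonal conjugation, which keeps the matrix with entries `d,
    -- b, c, a` multiplicative. The case `j = 3` is the same with `a, d` and `b, c` exchanged.
    have h2 : σ ξ * τ ξ = 1 := by simp only [σ, τ]; grind
    refine aux !![KAlg.d hξ, σ ξ • KAlg.b hξ; τ ξ • KAlg.c hξ, KAlg.a hξ] ξ ?_ ?_ ?_ ?_
    · ext i j; fin_cases i <;> fin_cases j <;> simp
    · intro i j
      fin_cases i <;> fin_cases j <;>
        simp [KAlg.comul_a, KAlg.comul_b, KAlg.comul_c, KAlg.comul_d,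
          TensorProduct.smul_tmul', TensorProduct.tmul_smul, smul_smul, h2,
          mul_comm (τ ξ), add_comm]
    · ext i j; fin_cases i <;> fin_cases j <;> simp
    · ext i j; fin_cases i <;> fin_cases j <;> simp [mul_comm]
  · rw [xiPow_two hξ] at hl2 ⊢
    have h2 : l ^ 2 = 1 := by grind
    refine aux !![KAlg.a hξ ^ 2, 0; τ (-1) • (KAlg.a hξ * KAlg.b hξ), 1] (-1) ?_ ?_ ?_ ?_
    · ext i j; fin_cases i <;> fin_cases j <;> simp
    · intro i j
      fin_cases i <;> fin_cases j <;>
        simp [KAlg.comul_a_mul_b, KAlg.comul_a_sq, Algebra.TensorProduct.one_def,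
          TensorProduct.smul_tmul', add_comm, -Bialgebra.comul_mul, -Bialgebra.comul_pow]
    · ext i j; fin_cases i <;> fin_cases j <;> simp [hx, sq]
    · ext i j; fin_cases i <;> fin_cases j <;>
        simp [KAlg.skewPrim_a_mul_b, KAlg.skewPrim_a_sq, σ, τ] <;> grind
  · rw [xiPow_three hξ] at hl2 ⊢
    have h2 : σ (-ξ) * τ (-ξ) = 1 := by simp only [σ, τ]; grind
    refine aux !![KAlg.a hξ, σ (-ξ) • KAlg.c hξ; τ (-ξ) • KAlg.b hξ, KAlg.d hξ] (-ξ) ?_ ?_ ?_ ?_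
    · ext i j; fin_cases i <;> fin_cases j <;> simp
    · intro i j
      fin_cases i <;> fin_cases j <;>
        simp [KAlg.comul_a, KAlg.comul_b, KAlg.comul_c, KAlg.comul_d,
          TensorProduct.smul_tmul', TensorProduct.tmul_smul, smul_smul, h2,
          mul_comm (τ (-ξ))]
    · ext i j; fin_cases i <;> fin_cases j <;> simp
    · ext i j; fin_cases i <;> fin_cases j <;> simp [mul_comm]

theorem exists_rep [CharZero 𝕜] {s : 𝕜} (hs : s ^ 2 = 2) {i j : ZMod 4} (hij : 2 * i ≠ j) :
    ∃ ρ : DK hξ →ₐ[𝕜] Matrix (Fin 2) (Fin 2) 𝕜, HasMatrixValues hξ s i j ρ := by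
  have hx := KAlg.xi_mul_xi hξ
  have hl := xiPow_pow_four hξ i
  have hm := xiPow_pow_four hξ j
  obtain ⟨ψ, hg, hx'⟩ := exists_dual_rep (hξ := hξ) s hij
  have hT : KAlg.IsKTuple ξ !![xiPow ξ i, 0; 0, xiPow ξ (i + 3)] !![0, (-1) ^ i.val; 0, 0]
      !![0, 1; 0, 0] !![xiPow ξ (-i), 0; 0, xiPow ξ (-i + 1)] := by
    simp only [neg_one_pow_val hξ, xiPow_add hξ, xiPow_neg hξ, xiPow_three hξ, xiPow_one]
    constructor <;> ext p q <;> fin_cases p <;> fin_cases q <;>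
      simp [pow_succ, Matrix.mul_apply, Fin.sum_univ_two] <;> grind
  let φ := KAlg.lift (hξ := hξ) hT
  have hc : IsCompatible s φ ψ := by
    constructor <;> simp only [hg, hx', φ, KAlg.lift_a, KAlg.lift_b, KAlg.lift_c, KAlg.lift_d,
      neg_one_pow_val hξ, xiPow_add hξ, xiPow_neg hξ, xiPow_three hξ, xiPow_one] <;>
      ext p q <;> fin_cases p <;> fin_cases q <;>
      simp [Matrix.mul_apply, Fin.sum_univ_two] <;> grind
  obtain ⟨Φ, h1, h2⟩ := exists_lift hs hc
  refine ⟨Φ, ?_, ?_, ?_, ?_, ?_, ?_⟩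
  · rw [← inclK_a, h1]; exact KAlg.lift_a hT
  · rw [← inclK_b, h1]; exact KAlg.lift_b hT
  · rw [← inclK_c, h1]; exact KAlg.lift_c hT
  · rw [← inclK_d, h1]; exact KAlg.lift_d hT
  · rw [← inclDual_gDual, h2, hg, xiPow_add hξ, xiPow_two hξ, mul_neg_one]
  · rw [← inclDual_xDual, h2, hx', xiPow_add hξ, xiPow_add hξ, xiPow_three_mul hξ]

end DK

/-! ### Highest weight vectors in `D`-modules -/

namespace DK

open KAlg (Dual gDual xDual ev)

variable {𝕜 : Type*} [Field 𝕜] {ξ : 𝕜} {hξ : IsPrimitiveRoot ξ 4}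

theorem c_mul_c : c hξ * c hξ = 0 := by
  rw [← inclK_c, ← map_mul, KAlg.c_mul_c, map_zero]
theorem a_mul_c : a hξ * c hξ = ξ • (c hξ * a hξ) := by
  rw [← inclK_c, ← inclK_a, ← map_mul, KAlg.a_mul_c, map_smul, map_mul]
theorem a_mul_a_mul_c : a hξ * (a hξ * c hξ) = b hξ := by
  rw [← inclK_c, ← inclK_a, ← map_mul, ← map_mul, KAlg.a_mul_a_mul, KAlg.a_sq_mul_c, inclK_b]
theorem a_mul_a_mul_a : a hξ * (a hξ * a hξ) = d hξ := by
  rw [← inclK_a, ← map_mul, ← map_mul, ← sq, KAlg.a_mul_a_sq, inclK_d]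
theorem a_pow_four : a hξ * (a hξ * (a hξ * a hξ)) = 1 := by
  rw [a_mul_a_mul_a, ← inclK_a, ← inclK_d, ← map_mul, KAlg.a_mul_d, map_one]
theorem g_pow_four : g hξ * (g hξ * (g hξ * g hξ)) = 1 := by
  have := congr_arg (inclDual hξ) (KAlg.gDual_pow_four (hξ := hξ))
  simpa only [map_mul, map_one, inclDual_gDual, mul_assoc] using this
theorem g_mul_x (s : 𝕜) : g hξ * x hξ s = -(x hξ s * g hξ) := by
  rw [← inclDual_gDual, ← inclDual_xDual, ← map_mul, KAlg.gDual_mul_xDual, map_neg, map_mul]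
theorem x_mul_x {s : 𝕜} (hs : s ^ 2 = 2) : x hξ s * x hξ s = g hξ * g hξ - 1 := by
  rw [← inclDual_gDual, ← inclDual_xDual, ← map_mul, KAlg.xDual_mul_xDual hs, map_sub, map_mul,
    map_one]

variable {M : Type*} [AddCommGroup M] [Module 𝕜 M] [Module (DK hξ) M]

variable (hξ) in
/-- A vector killed by `c` on which `a` and `g` act by `ξ ^ i` and `ξ ^ j`. -/
structure IsHighestWeight (i j : ZMod 4) (v : M) : Prop where
  c : c hξ • v = 0
  a : a hξ • v = xiPow ξ i • v
  g : g hξ • v = xiPow ξ j • v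

namespace IsHighestWeight

variable {i j : ZMod 4} {v : M}

theorem b (hv : IsHighestWeight hξ i j v) : b hξ • v = 0 := by
  rw [← a_mul_a_mul_c, mul_smul, mul_smul, hv.c, smul_zero, smul_zero]

theorem weight_eq {i' j' : ZMod 4} (hv : IsHighestWeight hξ i j v)
    (hv' : IsHighestWeight hξ i' j' v) (h0 : v ≠ 0) : i = i' ∧ j = j' :=
  ⟨xiPow_injective hξ (smul_left_injective 𝕜 h0 (hv.a.symm.trans hv'.a)),
    xiPow_injective hξ (smul_left_injective 𝕜 h0 (hv.g.symm.trans hv'.g))⟩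

/-- Used to compare two modules: an expansion of `z • (v, w)` has the same coefficients in both
components. -/
theorem prod {N : Type*} [AddCommGroup N] [Module 𝕜 N] [Module (DK hξ) N] {w : N}
    (hv : IsHighestWeight hξ i j v) (hw : IsHighestWeight hξ i j w) :
    IsHighestWeight hξ i j (v, w) :=
  ⟨Prod.ext hv.c hw.c, Prod.ext hv.a hw.a, Prod.ext hv.g hw.g⟩

variable [IsScalarTower 𝕜 (DK hξ) M]

theorem d (hv : IsHighestWeight hξ i j v) : d hξ • v = xiPow ξ i ^ 3 • v := by
  rw [← a_mul_a_mul_a, mul_smul, mul_smul]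
  simp only [hv.a, smul_comm (DK.a hξ) (_ : 𝕜), smul_smul (_ : 𝕜) (_ : 𝕜), pow_three, mul_assoc]

theorem inclK_smul (hv : IsHighestWeight hξ i j v) (h : KAlg hξ) :
    ∃ r : 𝕜, inclK hξ h • v = r • v := by
  have hh : h ∈ Algebra.adjoin 𝕜 {KAlg.a hξ, KAlg.c hξ} := by
    rw [KAlg.adjoin_a_c]; exact Algebra.mem_top
  induction hh using Algebra.adjoin_induction with
  | mem h hh =>
    rcases hh with rfl | rfl
    · exact ⟨_, hv.a⟩
    · exact ⟨0, hv.c.trans (zero_smul _ _).symm⟩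
  | algebraMap r => exact ⟨r, by rw [AlgHom.commutes, algebraMap_smul]⟩
  | add h h' _ _ hh hh' =>
    obtain ⟨r, hr⟩ := hh
    obtain ⟨r', hr'⟩ := hh'
    exact ⟨r + r', by rw [map_add, add_smul, hr, hr', add_smul]⟩
  | mul h h' _ _ hh hh' =>
    obtain ⟨r, hr⟩ := hh
    obtain ⟨r', hr'⟩ := hh'
    exact ⟨r' * r, by rw [map_mul, mul_smul, hr', smul_comm, hr, smul_smul]⟩

/-- In a product `f h` with `f` in the dual and `h` in `K`, the factor `h` acts on `v` by a scalar,
and `f` is a combination of the `g^k` and `x g^k`, where `g` acts by a scalar too. -/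
theorem smul_eq [CharZero 𝕜] {s : 𝕜} (hs : s ^ 2 = 2) (hv : IsHighestWeight hξ i j v)
    (z : DK hξ) : ∃ p q : 𝕜, z • v = p • v + q • x hξ s • v := by
  suffices h : z • v ∈ Submodule.span 𝕜 {v, x hξ s • v} by
    obtain ⟨p, q, h⟩ := Submodule.mem_span_pair.1 h
    exact ⟨p, q, h.symm⟩
  induction z using DrinfeldDouble.induction with
  | zero => simp
  | add y z hy hz => rw [add_smul]; exact Submodule.add_mem _ hy hz
  | mul f h =>
    obtain ⟨r, hr⟩ := hv.inclK_smul h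
    have hr' : DrinfeldDouble.inclH 𝕜 (Cop 𝕜 (KAlg hξ)) h • v = r • v := hr
    rw [mul_smul, hr', smul_comm]
    refine Submodule.smul_mem _ r ?_
    obtain ⟨p, q, rfl⟩ := KAlg.dual_eq_sum hs f
    refine Submodule.mem_span_pair.2 ⟨p 0 + p 1 * xiPow ξ j + p 2 * xiPow ξ j ^ 2 + p 3 * xiPow ξ j ^ 3,
      q 0 + q 1 * xiPow ξ j + q 2 * xiPow ξ j ^ 2 + q 3 * xiPow ξ j ^ 3, ?_⟩
    have hg (r : 𝕜) : DK.g hξ • r • v = (r * xiPow ξ j) • v := by rw [smul_comm, hv.g, smul_smul]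
    simp only [map_add, map_smul, map_mul, map_one, inclDual_gDual, inclDual_xDual, add_smul,
      smul_assoc, mul_smul (α := DK hξ), one_smul, hv.g, hg, smul_comm (x hξ s) (_ : 𝕜),
      smul_smul (_ : 𝕜) (_ : 𝕜), pow_three, sq, mul_assoc]

theorem g_smul_x_smul (s : 𝕜) (hv : IsHighestWeight hξ i j v) :
    DK.g hξ • x hξ s • v = xiPow ξ (j + 2) • x hξ s • v := by
  rw [smul_smul, g_mul_x, neg_smul, mul_smul, hv.g, smul_comm, xiPow_add hξ, xiPow_two hξ,
    mul_neg_one, neg_smul]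

theorem a_smul_x_smul (s : 𝕜) (hv : IsHighestWeight hξ i j v) :
    DK.a hξ • x hξ s • v = xiPow ξ (i + 3) • x hξ s • v := by
  rw [smul_smul, a_mul_x]
  simp only [add_smul, smul_assoc, mul_smul (α := DK hξ), hv.b, hv.c, hv.a, smul_zero, add_zero,
    smul_comm (x hξ s) (_ : 𝕜), smul_smul (_ : 𝕜) (_ : 𝕜), xiPow_add hξ, xiPow_three hξ,
    mul_comm]

/-- On `v` only the terms `d - g a` of the exchange relation for `c` and `x` survive. The vanishing
of this coefficient separates the one-dimensional from the two-dimensional simple modules. -/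
theorem c_smul_x_smul (s : 𝕜) (hv : IsHighestWeight hξ i j v) :
    DK.c hξ • x hξ s • v = (s * ξ * (xiPow ξ i ^ 3 - xiPow ξ i * xiPow ξ j)) • v := by
  rw [smul_smul, c_mul_x]
  simp only [add_smul, sub_smul, smul_assoc, mul_smul (α := DK hξ), hv.c, hv.a, hv.d, hv.g,
    smul_zero, zero_add, smul_comm (DK.g hξ) (_ : 𝕜), smul_smul (_ : 𝕜) (_ : 𝕜), mul_sub]

theorem smul (hv : IsHighestWeight hξ i j v) (r : 𝕜) : IsHighestWeight hξ i j (r • v) :=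
  ⟨by rw [smul_comm, hv.c, smul_zero], by rw [smul_comm, hv.a, smul_comm],
    by rw [smul_comm, hv.g, smul_comm]⟩

/-- The last factor is `ξ^i (ξ^{2i} - ξ^j)`. -/
theorem coeff_ne_zero [CharZero 𝕜] {s : 𝕜} (hs : s ^ 2 = 2) (hξ : IsPrimitiveRoot ξ 4)
    (hij : 2 * i ≠ j) : s * ξ * (xiPow ξ i ^ 3 - xiPow ξ i * xiPow ξ j) ≠ 0 := by
  intro h
  apply hij
  apply xiPow_injective hξ
  rw [xiPow_two_mul hξ]
  have hx := KAlg.xi_mul_xi hξ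
  have hl := xiPow_pow_four hξ i
  have h2 : (2 : 𝕜) ≠ 0 := by norm_num
  grind

/-- Otherwise `x v` would be a highest weight vector killed by `x`, hence would span a submodule. By
simplicity `v` would be a multiple of it, although its weight is different. -/
theorem x_smul_eq_zero [CharZero 𝕜] {s : 𝕜} (hs : s ^ 2 = 2) [IsSimpleModule (DK hξ) M]
    (hv : IsHighestWeight hξ i j v) (hij : 2 * i = j) : x hξ s • v = 0 := by
  by_contra h0
  have hl := xiPow_pow_four hξ i
  have hw : IsHighestWeight hξ (i + 3) (j + 2) (x hξ s • v) := by
    refine ⟨?_, hv.a_smul_x_smul s, hv.g_smul_x_smul s⟩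
    rw [hv.c_smul_x_smul, ← hij, xiPow_two_mul hξ, ← pow_succ', sub_self, mul_zero, zero_smul]
  have hxx : x hξ s • x hξ s • v = 0 := by
    rw [smul_smul, x_mul_x hs, sub_smul, mul_smul, hv.g, smul_comm, hv.g, smul_smul, one_smul,
      ← hij, xiPow_two_mul hξ, ← pow_add, hl, one_smul, sub_self]
  obtain ⟨z, hz⟩ := IsSimpleModule.toSpanSingleton_surjective (DK hξ) h0 v
  rw [LinearMap.toSpanSingleton_apply] at hz
  obtain ⟨p, q, h⟩ := hw.smul_eq hs z
  rw [hz, hxx, smul_zero, add_zero] at h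
  have hv0 : v ≠ 0 := by rintro rfl; exact h0 (smul_zero _)
  have hv' : IsHighestWeight hξ (i + 3) (j + 2) v := h ▸ hw.smul p
  -- This is `j = j + 2`, impossible modulo 4.
  have := (hv.weight_eq hv' hv0).2
  revert this
  generalize j = k
  revert k
  decide

/-- Write `w = p v + q x v`. Either `x v = 0`, or `c w` is a nonzero multiple of `q v`, which forces
`q = 0`. Thus the highest weight of a simple module is well defined. -/
theorem eq_smul [CharZero 𝕜] {s : 𝕜} (hs : s ^ 2 = 2) [IsSimpleModule (DK hξ) M]
    (hv : IsHighestWeight hξ i j v) (hv0 : v ≠ 0) {w : M} (hw : DK.c hξ • w = 0) :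
    ∃ r : 𝕜, w = r • v := by
  obtain ⟨z, rfl⟩ := IsSimpleModule.toSpanSingleton_surjective (DK hξ) hv0 w
  rw [LinearMap.toSpanSingleton_apply] at hw ⊢
  obtain ⟨p, q, h⟩ := hv.smul_eq hs z
  rw [h] at hw ⊢
  by_cases hij : 2 * i = j
  · exact ⟨p, by rw [hv.x_smul_eq_zero hs hij, smul_zero, add_zero]⟩
  · rw [smul_add, smul_comm, hv.c, smul_zero, zero_add, smul_comm, hv.c_smul_x_smul, smul_smul]
      at hw
    have hq := (smul_eq_zero.1 hw).resolve_right hv0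
    rw [(mul_eq_zero.1 hq).resolve_right (coeff_ne_zero hs hξ hij)]
    exact ⟨p, by rw [zero_smul, add_zero]⟩

theorem map {N : Type*} [AddCommGroup N] [Module 𝕜 N] [Module (DK hξ) N]
    [IsScalarTower 𝕜 (DK hξ) N] (hv : IsHighestWeight hξ i j v) (f : M →ₗ[DK hξ] N) :
    IsHighestWeight hξ i j (f v) :=
  ⟨by rw [← map_smul, hv.c, map_zero], by rw [← map_smul, hv.a, f.map_smul_of_tower],
    by rw [← map_smul, hv.g, f.map_smul_of_tower]⟩

/-- Both modules are cyclic, and whether `p v + q x v` vanishes depends only on `p`, `q` and the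
weight. So the annihilator of `v` kills `w`, and the induced nonzero map between simple modules is
bijective. -/
theorem nonempty_equiv [CharZero 𝕜] {s : 𝕜} (hs : s ^ 2 = 2) [IsSimpleModule (DK hξ) M]
    {N : Type*} [AddCommGroup N] [Module 𝕜 N] [Module (DK hξ) N] [IsScalarTower 𝕜 (DK hξ) N]
    [IsSimpleModule (DK hξ) N] {w : N} (hv : IsHighestWeight hξ i j v)
    (hw : IsHighestWeight hξ i j w) (hv0 : v ≠ 0) (hw0 : w ≠ 0) : Nonempty (M ≃ₗ[DK hξ] N) := by
  let f := LinearMap.toSpanSingleton (DK hξ) M v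
  let f' := LinearMap.toSpanSingleton (DK hξ) N w
  have hker : LinearMap.ker f ≤ LinearMap.ker f' := by
    intro z hz
    rw [LinearMap.mem_ker, LinearMap.toSpanSingleton_apply] at hz ⊢
    obtain ⟨p, q, h⟩ := (hv.prod hw).smul_eq hs z
    have h1 : z • v = p • v + q • x hξ s • v := congr_arg Prod.fst h
    have h2 : z • w = p • w + q • x hξ s • w := congr_arg Prod.snd h
    rw [h1] at hz
    rw [h2]
    by_cases hij : 2 * i = j
    · rw [hv.x_smul_eq_zero hs hij, smul_zero, add_zero] at hz
      rw [hw.x_smul_eq_zero hs hij, (smul_eq_zero.1 hz).resolve_right hv0]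
      simp
    -- Applying `c` isolates `q`, since `c v = 0` and `c x v` is a nonzero multiple of `v`.
    · have hq := congr_arg (DK.c hξ • ·) hz
      simp only [smul_add, smul_comm (DK.c hξ) (_ : 𝕜), hv.c, smul_zero, zero_add,
        hv.c_smul_x_smul, smul_smul (_ : 𝕜) (_ : 𝕜)] at hq
      have hq := (mul_eq_zero.1 ((smul_eq_zero.1 hq).resolve_right hv0)).resolve_right
        (coeff_ne_zero hs hξ hij)
      rw [hq, zero_smul, add_zero] at hz
      rw [hq, (smul_eq_zero.1 hz).resolve_right hv0]
      simp
  let e := f.quotKerEquivOfSurjective (IsSimpleModule.toSpanSingleton_surjective (DK hξ) hv0)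
  let F : M →ₗ[DK hξ] N := (LinearMap.ker f).liftQ f' hker ∘ₗ e.symm.toLinearMap
  have hF : F ≠ 0 := fun h => hw0 <| by
    have h1 := LinearMap.congr_fun h (e (Submodule.Quotient.mk 1))
    simpa [F, f'] using h1
  exact ⟨LinearEquiv.ofBijective F (LinearMap.bijective_of_ne_zero hF)⟩

end IsHighestWeight

/-- Here `T⁴ - 1` is the product of the factors `T - ξ^i`. Without an eigenvector in `S` each factor
would send nonzero vectors of `S` to nonzero vectors of `S`, whereas the product kills `v`. -/
theorem exists_eigenvector (hξ : IsPrimitiveRoot ξ 4) {V : Type*} [AddCommGroup V] [Module 𝕜 V]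
    (T : Module.End 𝕜 V) (hT : ∀ v, T (T (T (T v))) = v) (S : Submodule 𝕜 V)
    (hS : ∀ v ∈ S, T v ∈ S) {v : V} (hv : v ∈ S) (hv0 : v ≠ 0) :
    ∃ i : ZMod 4, ∃ w ∈ S, w ≠ 0 ∧ T w = xiPow ξ i • w := by
  by_contra! H
  have step (i : ZMod 4) (w : V) (hw : w ∈ S ∧ w ≠ 0) :
      T w - xiPow ξ i • w ∈ S ∧ T w - xiPow ξ i • w ≠ 0 :=
    ⟨S.sub_mem (hS w hw.1) (S.smul_mem _ hw.1), sub_ne_zero.2 (H i w hw.1 hw.2)⟩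
  refine (step 3 _ (step 2 _ (step 1 _ (step 0 v ⟨hv, hv0⟩)))).2 ?_
  have hx := KAlg.xi_mul_xi hξ
  simp only [xiPow_zero, xiPow_one, xiPow_two hξ, xiPow_three hξ, map_sub, map_smul, hT]
  match_scalars <;> grind

end DK

/-- The identity map onto the module of a representation. -/
def RepModule.mk {𝕜 A V : Type*} [Field 𝕜] [Ring A] [Algebra 𝕜 A] [AddCommGroup V] [Module 𝕜 V]
    (φ : A →ₐ[𝕜] Module.End 𝕜 V) : V ≃ₗ[𝕜] RepModule φ := LinearEquiv.refl 𝕜 V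

theorem RepModule.smul_mk {𝕜 A V : Type*} [Field 𝕜] [Ring A] [Algebra 𝕜 A] [AddCommGroup V]
    [Module 𝕜 V] (φ : A →ₐ[𝕜] Module.End 𝕜 V) (z : A) (v : V) :
    z • RepModule.mk φ v = RepModule.mk φ (φ z v) := rfl

/-! ### Simplicity and highest weights of the listed modules -/

namespace DK

variable {𝕜 : Type*} [Field 𝕜] {ξ : 𝕜} {hξ : IsPrimitiveRoot ξ 4}

/-- The kernel of `c` is nonzero because `c² = 0`. It is stable under `a` and `g`, since these
commute with `c` up to nonzero scalars, so it contains an eigenvector of `a`; within that eigenspace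
one finds an eigenvector of `g`, as `a g = g a`. -/
theorem exists_isHighestWeight {M : Type*} [AddCommGroup M] [Module 𝕜 M] [Module (DK hξ) M]
    [IsScalarTower 𝕜 (DK hξ) M] [Nontrivial M] :
    ∃ i j, ∃ v : M, v ≠ 0 ∧ IsHighestWeight hξ i j v := by
  let A := Module.toModuleEnd 𝕜 M (S := DK hξ) (a hξ)
  let C := Module.toModuleEnd 𝕜 M (S := DK hξ) (c hξ)
  let G := Module.toModuleEnd 𝕜 M (S := DK hξ) (g hξ)
  obtain ⟨u, hu, hu0⟩ : ∃ u ∈ LinearMap.ker C, u ≠ 0 := by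
    obtain ⟨w, hw⟩ := exists_ne (0 : M)
    by_cases h : c hξ • w = 0
    · exact ⟨w, h, hw⟩
    · refine ⟨c hξ • w, ?_, h⟩
      change c hξ • c hξ • w = 0
      rw [smul_smul, c_mul_c, zero_smul]
  have hA (v : M) (hv : v ∈ LinearMap.ker C) : A v ∈ LinearMap.ker C := by
    change c hξ • a hξ • v = 0
    have h0 : ξ ≠ 0 := hξ.ne_zero (by norm_num)
    have h1 : ξ • c hξ • a hξ • v = 0 := by
      rw [smul_smul (c hξ), ← smul_assoc, ← a_mul_c, mul_smul, show c hξ • v = 0 from hv,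
        smul_zero]
    exact (smul_eq_zero.1 h1).resolve_left h0
  have hG (v : M) (hv : v ∈ LinearMap.ker C) : G v ∈ LinearMap.ker C := by
    change c hξ • g hξ • v = 0
    rw [smul_smul, c_mul_g, neg_smul, mul_smul, show c hξ • v = 0 from hv, smul_zero, neg_zero]
  have hA4 (v : M) : A (A (A (A v))) = v := by
    change a hξ • a hξ • a hξ • a hξ • v = v
    rw [smul_smul, smul_smul, smul_smul, mul_assoc, mul_assoc, a_pow_four, one_smul]
  have hG4 (v : M) : G (G (G (G v))) = v := by
    change g hξ • g hξ • g hξ • g hξ • v = v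
    rw [smul_smul, smul_smul, smul_smul, mul_assoc, mul_assoc, g_pow_four, one_smul]
  obtain ⟨i, v, hv, hv0, hvi⟩ := exists_eigenvector hξ A hA4 _ hA hu hu0
  obtain ⟨j, w, hw, hw0, hwj⟩ := exists_eigenvector hξ G hG4
    (LinearMap.ker C ⊓ LinearMap.ker (A - xiPow ξ i • 1)) (by
      rintro w ⟨h1, h2⟩
      refine ⟨hG w h1, ?_⟩
      have h2 : a hξ • w = xiPow ξ i • w := sub_eq_zero.1 h2
      refine sub_eq_zero.2 ?_
      change a hξ • g hξ • w = xiPow ξ i • g hξ • w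
      rw [smul_smul, a_mul_g, mul_smul, h2, smul_comm]) ⟨hv, LinearMap.mem_ker.2 (sub_eq_zero.2 hvi)⟩ hv0
  exact ⟨i, j, w, hw0, hw.1, sub_eq_zero.1 hw.2, hwj⟩

theorem isHighestWeight_char {s : 𝕜} {j : ZMod 4} {χ : DK hξ →ₐ[𝕜] 𝕜}
    (h : HasCharValues hξ s j χ) :
    IsHighestWeight hξ j (2 * j) (RepModule.mk ((Algebra.lmul 𝕜 𝕜).comp χ) 1) := by
  refine ⟨?_, ?_, ?_⟩ <;> rw [RepModule.smul_mk]
  · simp [h.c]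
  · rw [← map_smul]
    simp [h.a]
  · rw [← map_smul]
    simp [h.g, neg_one_pow_val hξ, xiPow_two_mul hξ]

theorem isSimpleModule_char (χ : DK hξ →ₐ[𝕜] 𝕜) : IsSimpleModule (DK hξ) (CharModule χ) := by
  have : Nontrivial (CharModule χ) := inferInstanceAs (Nontrivial 𝕜)
  refine isSimpleModule_iff_toSpanSingleton_surjective.2 ⟨this, fun v hv w => ?_⟩
  obtain ⟨v, rfl⟩ := (RepModule.mk _).surjective v
  obtain ⟨w, rfl⟩ := (RepModule.mk _).surjective w
  have hv : v ≠ 0 := fun h => hv (by rw [h, map_zero])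
  refine ⟨algebraMap 𝕜 (DK hξ) (w / v), ?_⟩
  rw [LinearMap.toSpanSingleton_apply, RepModule.smul_mk, AlgHom.commutes]
  simp [hv]

theorem isHighestWeight_mat {s : 𝕜} {i j : ZMod 4} {ρ : DK hξ →ₐ[𝕜] Matrix (Fin 2) (Fin 2) 𝕜}
    (h : HasMatrixValues hξ s i j ρ) : IsHighestWeight hξ i j
      (RepModule.mk ((Matrix.toLinAlgEquiv' (R := 𝕜) (n := Fin 2)).toAlgHom.comp ρ) ![1, 0]) := by
  refine ⟨?_, ?_, ?_⟩ <;> rw [RepModule.smul_mk]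
  · rw [← map_zero (RepModule.mk _)]
    congr 1
    ext k; fin_cases k <;> simp [h.c]
  · rw [← map_smul]
    congr 1
    ext k; fin_cases k <;> simp [h.a]
  · rw [← map_smul]
    congr 1
    ext k; fin_cases k <;> simp [h.g]

theorem isSimpleModule_mat [CharZero 𝕜] {s : 𝕜} (hs : s ^ 2 = 2) {i j : ZMod 4} (hij : 2 * i ≠ j)
    {ρ : DK hξ →ₐ[𝕜] Matrix (Fin 2) (Fin 2) 𝕜} (h : HasMatrixValues hξ s i j ρ) :
    IsSimpleModule (DK hξ) (MatModule ρ) := by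
  have hκ := IsHighestWeight.coeff_ne_zero hs hξ hij
  rw [← xiPow_three_mul hξ, ← xiPow_add hξ] at hκ
  have : Nontrivial (MatModule ρ) := inferInstanceAs (Nontrivial (Fin 2 → 𝕜))
  have hx := h.x
  set κ := s * ξ * (xiPow ξ (3 * i) - xiPow ξ (i + j))
  -- The first basis vector generates, because `x` sends it to `κ ≠ 0` times the second. It remains
  -- to reach it from any nonzero vector: by `c` if the second coordinate is nonzero, by scaling
  -- otherwise.
  have key (w : Fin 2 → 𝕜) : ∃ z : DK hξ, Matrix.mulVec (ρ z) ![1, 0] = w := by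
    refine ⟨w 0 • 1 + (w 1 / κ) • x hξ s, ?_⟩
    rw [map_add, map_smul, map_smul, map_one, hx]
    ext k; fin_cases k <;> simp [Matrix.add_mulVec, Matrix.smul_mulVec, hκ]
  refine isSimpleModule_iff_toSpanSingleton_surjective.2 ⟨this, fun v hv w => ?_⟩
  let v' : Fin 2 → 𝕜 := v
  suffices h1 : ∃ z : DK hξ, Matrix.mulVec (ρ z) v' = ![1, 0] by
    obtain ⟨z, hz⟩ := h1
    obtain ⟨y, hy⟩ := key w
    refine ⟨y * z, ?_⟩
    change Matrix.mulVec (ρ (y * z)) v' = w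
    rw [map_mul, ← Matrix.mulVec_mulVec, hz, hy]
  by_cases h1 : v' 1 = 0
  · have h0 : v' 0 ≠ 0 := fun h0 => hv <| by
      change v' = 0
      ext k; fin_cases k
      exacts [h0, h1]
    refine ⟨algebraMap 𝕜 _ (v' 0)⁻¹, ?_⟩
    rw [AlgHom.commutes, Algebra.algebraMap_eq_smul_one, Matrix.smul_mulVec, Matrix.one_mulVec]
    ext k; fin_cases k <;> simp [h0, h1]
  · refine ⟨(v' 1)⁻¹ • c hξ, ?_⟩
    rw [map_smul, Matrix.smul_mulVec, h.c]
    ext k; fin_cases k <;> simp [dotProduct, h1]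

/-- The highest weights of the modules in `simpleFamily`. -/
def weight : ZMod 4 ⊕ Lam → ZMod 4 × ZMod 4
  | .inl j => (j, 2 * j)
  | .inr p => p.1

/-- The pairs `(j, 2j)` are exactly the complement of `Λ` in `ℤ/4 × ℤ/4`. -/
theorem weight_bijective : Function.Bijective weight := by
  constructor
  · rintro (i | ⟨p, hp⟩) (j | ⟨q, hq⟩) h
    · exact congr_arg _ (Prod.ext_iff.1 h).1
    · obtain rfl : (i, 2 * i) = q := h
      exact absurd rfl hq
    · obtain rfl : p = (j, 2 * j) := h
      exact absurd rfl hp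
    · obtain rfl : p = q := h
      rfl
  · rintro ⟨i, j⟩
    by_cases h : 2 * i = j
    · exact ⟨.inl i, Prod.ext rfl h⟩
    · exact ⟨.inr ⟨(i, j), h⟩, rfl⟩

end DK

/-! ### The classification -/

theorem mainTheorem3 {𝕜 : Type u} [Field 𝕜] [IsAlgClosed 𝕜] [CharZero 𝕜]
    {ξ : 𝕜} (hξ : IsPrimitiveRoot ξ 4) {s : 𝕜} (hs : s ^ 2 = 2) :
    Module.finrank 𝕜 (DK hξ) = 64 ∧
    ∃ (χ : ZMod 4 → (DK hξ →ₐ[𝕜] 𝕜)) (ρ : Lam → (DK hξ →ₐ[𝕜] Matrix (Fin 2) (Fin 2) 𝕜)),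
      -- `χ j` and `ρ p` are the unique algebra maps with the prescribed values on generators
      (∀ j φ, HasCharValues hξ s j φ ↔ φ = χ j) ∧
      (∀ p φ, HasMatrixValues hξ s p.1.1 p.1.2 φ ↔ φ = ρ p) ∧
      -- dimensions
      (∀ j, Module.finrank 𝕜 (CharModule (χ j)) = 1) ∧
      (∀ p, Module.finrank 𝕜 (MatModule (ρ p)) = 2) ∧
      -- there are four plus twelve modules in the list
      Nat.card (ZMod 4) = 4 ∧ Nat.card Lam = 12 ∧ Nat.card (ZMod 4 ⊕ Lam) = 16 ∧
      -- all of them are simple, and they are pairwise non-isomorphic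
      (∀ t, IsSimpleModule (DK hξ) (simpleFamily hξ χ ρ t)) ∧
      (∀ t t', Nonempty (simpleFamily hξ χ ρ t ≃ₗ[DK hξ] simpleFamily hξ χ ρ t') → t = t') ∧
      -- every simple module is isomorphic to one of them
      (∀ (M : Type v) [AddCommGroup M] [Module (DK hξ) M], IsSimpleModule (DK hξ) M →
        ∃ t, Nonempty (M ≃ₗ[DK hξ] simpleFamily hξ χ ρ t)) := by
  choose χ hχ using DK.exists_char (hξ := hξ) hs
  choose ρ hρ using fun p : Lam => DK.exists_rep (hξ := hξ) hs p.2
  have hLam : Nat.card Lam = 12 := by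
    rw [Nat.card_eq_fintype_card]; decide
  let fam := simpleFamily hξ χ ρ
  let modFam (t) : Module 𝕜 (fam t) := Module.compHom _ (algebraMap 𝕜 (DK hξ))
  have towFam (t) : IsScalarTower 𝕜 (DK hξ) (fam t) := IsScalarTower.of_algebraMap_smul
    fun _ _ => rfl
  have hsimple (t) : IsSimpleModule (DK hξ) (fam t) := by
    rcases t with j | p
    · exact DK.isSimpleModule_char (χ j)
    · exact DK.isSimpleModule_mat hs p.2 (hρ p)
  have hw (t) : ∃ v : fam t, v ≠ 0 ∧
      DK.IsHighestWeight hξ (DK.weight t).1 (DK.weight t).2 v := by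
    -- Scalars act on `RepModule φ` through `V`, but on `fam t` through `D`. Writing the eigenvalues
    -- as elements of `D` lets the equations pass from one structure to the other.
    have aux {V : Type u} [AddCommGroup V] [Module 𝕜 V] {φ : DK hξ →ₐ[𝕜] Module.End 𝕜 V} (v : V)
        (hv : v ≠ 0) {i j} (h : DK.IsHighestWeight hξ i j (RepModule.mk φ v)) :
        ∃ v : RepModule φ, v ≠ 0 ∧ DK.c hξ • v = 0 ∧
          DK.a hξ • v = algebraMap 𝕜 (DK hξ) (xiPow ξ i) • v ∧
          DK.g hξ • v = algebraMap 𝕜 (DK hξ) (xiPow ξ j) • v :=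
      ⟨_, (RepModule.mk φ).map_ne_zero_iff.2 hv, h.c, h.a.trans (algebraMap_smul _ _ _).symm,
        h.g.trans (algebraMap_smul _ _ _).symm⟩
    rcases t with j | p
    · obtain ⟨v, hv, hc, ha, hg⟩ := aux 1 one_ne_zero (DK.isHighestWeight_char (hχ j))
      exact ⟨v, hv, hc, ha, hg⟩
    · obtain ⟨v, hv, hc, ha, hg⟩ := aux ![1, 0] (fun h => one_ne_zero (congr_fun h 0))
        (DK.isHighestWeight_mat (hρ p))
      exact ⟨v, hv, hc, ha, hg⟩
  refine ⟨DK.finrank_eq hξ, χ, ρ, fun j φ => ⟨fun h => ?_, fun h => h ▸ hχ j⟩,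
    fun p φ => ⟨fun h => ?_, fun h => h ▸ hρ p⟩, fun j => Module.finrank_self 𝕜,
    fun p => (Module.finrank_fin_fun 𝕜 (n := 2)), by simp, hLam, ?_, hsimple, ?_, ?_⟩
  · have h' := hχ j
    exact DK.algHom_ext hs (h.a.trans h'.a.symm) (h.b.trans h'.b.symm) (h.c.trans h'.c.symm)
      (h.d.trans h'.d.symm) (h.g.trans h'.g.symm) (h.x.trans h'.x.symm)
  · have h' := hρ p
    exact DK.algHom_ext hs (h.a.trans h'.a.symm) (h.b.trans h'.b.symm) (h.c.trans h'.c.symm)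
      (h.d.trans h'.d.symm) (h.g.trans h'.g.symm) (h.x.trans h'.x.symm)
  · rw [Nat.card_sum, hLam]; simp
  · rintro t t' ⟨e⟩
    obtain ⟨v, hv0, hv⟩ := hw t
    obtain ⟨v', hv0', hv'⟩ := hw t'
    let f : fam t →ₗ[DK hξ] fam t' := e.toLinearMap
    have hev := hv.map f
    have := hsimple t'
    -- The image of `v` is killed by `c`, so it lies on the highest weight line of the target, and
    -- the two weights agree.
    obtain ⟨r, hr⟩ := hv'.eq_smul hs hv0' hev.c
    have h := hev.weight_eq (hr ▸ hv'.smul r) (e.map_ne_zero_iff.2 hv0)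
    exact DK.weight_bijective.1 (Prod.ext h.1 h.2)
  · intro M _ _ hM
    -- `M` comes only with its action of `D`; weights need scalars, which act through `D`.
    let : Module 𝕜 M := Module.compHom _ (algebraMap 𝕜 (DK hξ))
    have : IsScalarTower 𝕜 (DK hξ) M := IsScalarTower.of_algebraMap_smul fun _ _ => rfl
    have := hM.nontrivial
    obtain ⟨i, j, v, hv0, hv⟩ := DK.exists_isHighestWeight (hξ := hξ) (M := M)
    obtain ⟨t, ht⟩ := DK.weight_bijective.2 (i, j)
    obtain ⟨w, hw0, hw⟩ := hw t
    rw [ht] at hw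
    have := hsimple t
    exact ⟨t, hv.nonempty_equiv hs hw hv0 hw0⟩

end
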